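/- Let $N$ be a (Hausdorff) complex manifold of complex dimension $n$ with complex structure $J$, a Kähler metric $h$ and Kähler form $\Omega(u,v)=h(Ju,v)$. Let $f=f_1+if_2\colon N\to\mathbb C$ be a Lefschetz fibration, i.e. a holomorphic function with finitely many critical points, at each of which the complex Hessian of $f$ is nondegenerate. Let $V\subset N$ be a Lagrangian submanifold (an embedded smooth submanifold of real dimension $n$ on which $\Omega$ vanishes) containing a critical point $x$ of $f$. Suppose that $f_2$ is constant on $V$ and that the restriction to $T_xV$ of the Hessian of $f$ at $x$ is negative definite (resp. positive definite), i.e. $\operatorname{Re}\operatorname{Hess}f(x)(v,v)<0$ (resp. $>0$) for all $0\neq v\in T_xV$. Put $g_1=f_1|_V$. For real $c<f_1(x)$ (resp. $c>f_1(x)$) consider $$K_c=g_1^{-1}[c,g_1(x)]=f_1^{-1}[c,f_1(x)]\cap V\qquad\bigl(\text{resp. } K_c=g_1^{-1}[g_1(x),c]=f_1^{-1}[f_1(x),c]\cap V\bigr),$$ and let $D_c$ be the part of $K_c$ near $x$, that is, the connected component of $x$ in $K_c$ (so $D_c=K_c$ whenever $K_c$ is connected). Then: 1. For every sufficiently small neighbourhood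 $U$ of $x$ in $N$ one has $D_c=K_c\cap U$ for all $c$ sufficiently near $f_1(x)$ (how near may depend on $U$). 2. For all $c$ sufficiently near $f_1(x)$, $D_c$ is homeomorphic to a closed ball in $\mathbb R^{\dim V}$, and $D_c$ is a Lagrangian thimble of $f$ at $x$ with boundary $\alpha=D_c\cap f_1^{-1}(c)$, obtained by parallel transport along the segment $\gamma(t)=(1-t)\,(c+if_2(x))+t\,f(x)$, $0\le t\le 1$, on which the imaginary part is constant. Here "$D$ is a Lagrangian thimble of $f$ at $x$ over $\gamma$ with boundary $\alpha$" means: $\gamma(1)=f(x)$ and $\gamma(t)$ is a regular value of $f$ for $0\le t<1$; $\alpha$ is a Lagrangian submanifold (embedded, of real dimension $n-1$, with $\Omega|_\alpha=0$) of the fibre $f^{-1}(\gamma(0))$; every $y\in\alpha$ has a horizontal lift $t\mapsto\tau_t(y)$, $0\le t<1$, of $\gamma$ starting at $y$, for the connection whose horizontal spaces are the $\Omega$-orthogonals of $\ker df$; the cycles $\tau_t(\alpha)$ collapse to $x$ as $t\to1$; $D=\{x\}\cup\bigcup_{0\le t<1}\tau_t(\alpha)$; there is a homeomorphism of $D$ onto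 the closed unit ball of $\mathbb R^n$ that takes $\alpha$ onto the unit sphere; and $D$ is an embedded smooth $n$-dimensional submanifold with boundary of $N$ on which $\Omega$ vanishes. -/

import Mathlib

open Set Filter Topology Metric
open scoped Manifold ContDiff

noncomputable section

namespace LefschetzThimble

/-- A complex (holomorphic) manifold is a smooth real manifold, with the same charts. -/
instance isManifold_real {E : Type*} [NormedAddCommGroup E] [NormedSpace ℂ E]
    {N : Type*} [TopologicalSpace N] [ChartedSpace E N] [IsManifold 𝓘(ℂ, E) ω N] :
    IsManifold 𝓘(ℝ, E) ∞ N := by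
  apply isManifold_of_contDiffOn
  intro e e' he he'
  have h := (contDiffGroupoid ω 𝓘(ℂ, E)).compatible he he'
  rw [contDiffGroupoid, mem_groupoid_of_pregroupoid] at h
  have h1 := h.1
  simp only [contDiffPregroupoid, modelWithCornersSelf_coe, modelWithCornersSelf_coe_symm,
    Function.id_comp, Function.comp_id, preimage_id_eq, id_eq, range_id, inter_univ] at h1 ⊢
  exact (h1.restrict_scalars ℝ).of_le le_top

section Kaehler

variable (E : Type*) [NormedAddCommGroup E] [NormedSpace ℂ E]
  (N : Type*) [TopologicalSpace N] [ChartedSpace E N]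

variable {E N} in
/-- The complex structure `J` on the real tangent spaces of a complex manifold modelled on `E`:
multiplication by `i`. -/
def complexStructure (y : N) (v : TangentSpace 𝓘(ℝ, E) y) : TangentSpace 𝓘(ℝ, E) y :=
  (Complex.I • (show E from v) : E)

/-- A smooth Riemannian metric that is invariant under `J`, i.e. the real part of a smooth
Hermitian metric on the complex manifold `N`. -/
structure HermitianMetric [IsManifold 𝓘(ℂ, E) ω N] extends
    Bundle.ContMDiffRiemannianMetric 𝓘(ℝ, E) ∞ E (fun y : N => TangentSpace 𝓘(ℝ, E) y) where
  inner_J : ∀ (y : N) (u v : TangentSpace 𝓘(ℝ, E) y),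
    inner y (complexStructure y u) (complexStructure y v) = inner y u v

variable {E N}

/-- The fundamental form `Ω(u, v) = h(Ju, v)` of a Hermitian metric. -/
def HermitianMetric.form [IsManifold 𝓘(ℂ, E) ω N] (h : HermitianMetric E N) (y : N)
    (u v : TangentSpace 𝓘(ℝ, E) y) : ℝ :=
  h.inner y (complexStructure y u) v

/-- The form `Ω` read in the preferred chart at `p`: its value at the point `z` of the chart, on
the constant coordinate vector fields `u`, `v`. -/
def HermitianMetric.formInChart [IsManifold 𝓘(ℂ, E) ω N] (h : HermitianMetric E N) (p : N)
    (u v : E) (z : E) : ℝ :=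
  h.form ((chartAt E p).symm z)
    (mfderiv 𝓘(ℝ, E) 𝓘(ℝ, E) (chartAt E p).symm z u)
    (mfderiv 𝓘(ℝ, E) 𝓘(ℝ, E) (chartAt E p).symm z v)

variable (E N) in
/-- A Kähler metric: a Hermitian metric with `dΩ = 0`. On constant coordinate fields,
`dΩ(u, v, w)` is the cyclic sum of the derivatives of `Ω(v, w)` in the direction `u`. -/
structure KaehlerMetric [IsManifold 𝓘(ℂ, E) ω N] extends HermitianMetric E N where
  closed : ∀ (p : N) (u v w : E),
    fderiv ℝ (toHermitianMetric.formInChart p v w) (chartAt E p p) u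
      + fderiv ℝ (toHermitianMetric.formInChart p w u) (chartAt E p p) v
      + fderiv ℝ (toHermitianMetric.formInChart p u v) (chartAt E p p) w = 0

end Kaehler

section Fibration

variable {E : Type*} [NormedAddCommGroup E] [NormedSpace ℂ E]
  {N : Type*} [TopologicalSpace N] [ChartedSpace E N]

/-- `y` is a critical point of `f : N → ℂ`. As `df` at `y` is a complex linear map to `ℂ`, it is
surjective if and only if it is not zero. -/
def IsCriticalPoint (f : N → ℂ) (y : N) : Prop :=
  mfderiv 𝓘(ℂ, E) 𝓘(ℂ, ℂ) f y = 0

/-- `z` is a regular value: no critical point lies over it. -/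
def IsRegularValue (f : N → ℂ) (z : ℂ) : Prop :=
  ∀ y : N, f y = z → ¬ IsCriticalPoint (E := E) f y

/-- The complex Hessian of `f` at `y`: the second derivative in the preferred chart at `y`, by
which the tangent space at `y` is identified with `E`. At a critical point it does not depend on
the chart. -/
def hessian (f : N → ℂ) (y : N) : E →L[ℂ] E →L[ℂ] ℂ :=
  fderiv ℂ (fderiv ℂ (f ∘ (chartAt E y).symm)) (chartAt E y y)

variable (E) in
/-- A (topological) Lefschetz fibration on the complex manifold `N`: a holomorphic function with
finitely many critical points, all of them nondegenerate. -/
structure IsLefschetzFibration (f : N → ℂ) : Prop where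
  holomorphic : ContMDiff 𝓘(ℂ, E) 𝓘(ℂ, ℂ) ω f
  finite_critical : {y : N | IsCriticalPoint (E := E) f y}.Finite
  nondegenerate : ∀ y : N, IsCriticalPoint (E := E) f y →
    ∀ u : E, (∀ v : E, hessian f y u v = 0) → u = 0

end Fibration

section Submanifolds

variable {E : Type*} [NormedAddCommGroup E] [NormedSpace ℂ E]
  {N : Type*} [TopologicalSpace N] [ChartedSpace E N] [IsManifold 𝓘(ℂ, E) ω N]

/-- `φ`, on the intersection of the open set `W` with the half-space `ℓ ≥ 0` of `ℝᵏ`, is a smooth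
parametrization of a neighbourhood of `p = φ 0` in `S`: it is a smooth immersion and a
homeomorphism onto a relatively open part of `S`; the form `Ω` pulls back to zero along it.
For `ℓ = 0` the half-space is all of `ℝᵏ`; otherwise `p` is a boundary point. -/
structure IsIsotropicParametrization (h : HermitianMetric E N) (k : ℕ) (S : Set N) (p : N)
    (ℓ : EuclideanSpace ℝ (Fin k) →L[ℝ] ℝ) (W : Set (EuclideanSpace ℝ (Fin k)))
    (φ : EuclideanSpace ℝ (Fin k) → N) : Prop where
  isOpen : IsOpen W
  zero_mem : 0 ∈ W
  map_zero : φ 0 = p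
  smooth : ContMDiffOn 𝓘(ℝ, EuclideanSpace ℝ (Fin k)) 𝓘(ℝ, E) ∞ φ W
  immersion : ∀ a ∈ W, 0 ≤ ℓ a →
    Function.Injective (mfderiv 𝓘(ℝ, EuclideanSpace ℝ (Fin k)) 𝓘(ℝ, E) φ a)
  embedding : IsEmbedding ((W ∩ {a | 0 ≤ ℓ a}).domRestrict φ)
  image : ∃ O : Set N, IsOpen O ∧ φ '' (W ∩ {a | 0 ≤ ℓ a}) = S ∩ O
  isotropic : ∀ a ∈ W, 0 ≤ ℓ a → ∀ u v : EuclideanSpace ℝ (Fin k),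
    h.form (φ a)
      (mfderiv 𝓘(ℝ, EuclideanSpace ℝ (Fin k)) 𝓘(ℝ, E) φ a u)
      (mfderiv 𝓘(ℝ, EuclideanSpace ℝ (Fin k)) 𝓘(ℝ, E) φ a v) = 0

/-- `S` is an embedded smooth `k`-dimensional submanifold (without boundary, not necessarily
closed) of `N` on which `Ω` vanishes. -/
def IsIsotropicSubmanifold (h : HermitianMetric E N) (k : ℕ) (S : Set N) : Prop :=
  ∀ p ∈ S, ∃ W φ, IsIsotropicParametrization h k S p 0 W φ

/-- The same for a submanifold with (possibly empty) boundary. -/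
def IsIsotropicSubmanifoldWithBoundary (h : HermitianMetric E N) (k : ℕ) (S : Set N) : Prop :=
  ∀ p ∈ S, ∃ ℓ W φ, IsIsotropicParametrization h k S p ℓ W φ

/-- A Lagrangian submanifold: isotropic, of half the real dimension of `N`. -/
def IsLagrangianSubmanifold (h : HermitianMetric E N) (V : Set N) : Prop :=
  IsIsotropicSubmanifold h (Module.finrank ℂ E) V

variable (E) in
/-- The tangent space `T_x V`: the velocities at `x` of the smooth curves in `V` through `x`,
in the identification of the tangent space of `N` at `x` with `E`. -/
def tangentVectors (V : Set N) (x : N) : Set E :=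
  {v | ∃ γ : ℝ → N, γ 0 = x ∧ ContMDiffAt 𝓘(ℝ, ℝ) 𝓘(ℝ, E) ∞ γ 0 ∧ (∀ᶠ t in 𝓝 0, γ t ∈ V) ∧
    mfderiv 𝓘(ℝ, ℝ) 𝓘(ℝ, E) γ 0 (1 : ℝ) = v}

/-- `σ` is a horizontal lift over `[0, 1)` of the path `γ`, for the connection whose horizontal
spaces are the `Ω`-orthogonals of the tangent spaces `ker df` of the fibres. -/
def IsHorizontalLift (h : HermitianMetric E N) (f : N → ℂ) (γ : ℝ → ℂ) (σ : ℝ → N) : Prop :=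
  ∀ t ∈ Ico (0 : ℝ) 1, f (σ t) = γ t ∧
    MDifferentiableWithinAt 𝓘(ℝ, ℝ) 𝓘(ℝ, E) σ (Ico 0 1) t ∧
    ∀ w : E, mfderiv 𝓘(ℂ, E) 𝓘(ℂ, ℂ) f (σ t) w = 0 →
      h.form (σ t) (mfderivWithin 𝓘(ℝ, ℝ) 𝓘(ℝ, E) σ (Ico 0 1) t (1 : ℝ)) w = 0

/-- `D` is a Lagrangian thimble of `f` at the critical point `x`, over the path `γ` from the
regular value `γ 0` to `f x`, with vanishing cycle `α`: a closed disc with boundary `α`, traced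
by the Lagrangian cycle `α` in the fibre over `γ 0` as it is moved by parallel transport along `γ`
and collapses to `x`, and a Lagrangian submanifold (with boundary) of `N`. -/
structure IsLagrangianThimble (h : HermitianMetric E N) (f : N → ℂ) (γ : ℝ → ℂ) (x : N)
    (α D : Set N) : Prop where
  critical : IsCriticalPoint (E := E) f x
  path : ContinuousOn γ (Icc 0 1)
  path_end : γ 1 = f x
  path_regular : ∀ t ∈ Ico (0 : ℝ) 1, IsRegularValue (E := E) f (γ t)
  cycle_fibre : ∀ y ∈ α, f y = γ 0
  cycle_lagrangian : IsIsotropicSubmanifold h (Module.finrank ℂ E - 1) α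
  /-- For each point `y` of `α`, `t ↦ τ t y` is its parallel transport along `γ`. -/
  transport : ∃ τ : ℝ → N → N,
    (∀ y ∈ α, τ 0 y = y ∧ IsHorizontalLift h f γ (fun t => τ t y)) ∧
    (∀ U ∈ 𝓝 x, ∀ᶠ t in 𝓝[<] (1 : ℝ), ∀ y ∈ α, τ t y ∈ U) ∧
    D = insert x (⋃ t ∈ Ico (0 : ℝ) 1, τ t '' α)
  disc : ∃ Φ : D ≃ₜ closedBall (0 : EuclideanSpace ℝ (Fin (Module.finrank ℂ E))) 1,
    ∀ p : D, (p : N) ∈ α ↔ ‖(Φ p : EuclideanSpace ℝ (Fin (Module.finrank ℂ E)))‖ = 1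
  lagrangian : IsIsotropicSubmanifoldWithBoundary h (Module.finrank ℂ E) D

end Submanifolds

end LefschetzThimble

end

/-! Take a parametrization `φ` of `V` by `ℝⁿ` near `x = φ 0`, a sign `s = ±1`, and put `q = s (Re
f(x) - Re f ∘ φ)`. Both cases of the theorem become one statement about `q`, with `ρ = |f₁(x) - c|`.
Since `x` is critical, the second derivative of `q` at `0` is `-s Re Hess f` pulled back by `dφ`,
which is positive definite. So on a small ball `q` is convex and has its only critical point, a
minimum, at `0` (`exists_isConvexWell`). Convexity takes the place of Morse coordinates.

Topology: a small sublevel set `{q ≤ ρ}` is a compact convex body with frontier `{q = ρ}`, hence a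
disc; since `dq ≠ 0` away from `0` it is smooth with smooth boundary. Its image in `V` is connected,
compact and relatively open in `K_c`, so it is the component of `x` (`connectedComponentIn_eq`). All
of it is isotropic because it lies in `V`.

Parallel transport: let `Y` be the gradient of `q` for the metric induced on `V`. As `V` is
Lagrangian, `TN = TV ⊕ J TV` along `V`. Let `w = u + Jv` be in `ker df`. As `Im f` is constant on
`V`, `df` is real on `TV`, so the imaginary part of `df(w) = 0` says `df(v) = 0`. Hence `Ω(Y, w) =
Ω(Y, u) + h(JY, Jv) = 0 + dq(v) = 0`: the gradient is horizontal (`form_gradient_eq_zero`). Its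
descending flow, timed so that `q` falls linearly from `ρ` to `0`, is therefore the parallel
transport along `γ`. It stays in the sublevel set, tends to the minimum, and followed backwards from
any other point it reaches `{q = ρ}` (`exists_transport`), so it sweeps out the disc. The values of
`γ` before its end are regular because the critical values are finite in number. -/

noncomputable section

namespace LefschetzThimble

/-! ### Convex wells and their sublevel sets -/

section ConvexWell

variable {F : Type*} [NormedAddCommGroup F] [NormedSpace ℝ F]

/-- A smooth convex function on the closed ball of radius `r` with its only minimum at `0`. -/
structure IsConvexWell (q : F → ℝ) (r : ℝ) : Prop where
  radius_pos : 0 < r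
  smooth : ∀ a ∈ closedBall (0 : F) r, ContDiffAt ℝ ∞ q a
  map_zero : q 0 = 0
  convex : ConvexOn ℝ (closedBall 0 r) q
  fderiv_zero : fderiv ℝ q 0 = 0
  pos : ∀ a ∈ closedBall (0 : F) r, a ≠ 0 → 0 < q a
  fderiv_pos : ∀ a ∈ closedBall (0 : F) r, a ≠ 0 → 0 < fderiv ℝ q a a

/-- The sublevel set of `q` in the closed ball of radius `r`. -/
def sublevel (q : F → ℝ) (r ρ : ℝ) : Set F := {a ∈ closedBall 0 r | q a ≤ ρ}

/-- A function with monotone derivative on a convex set is convex. -/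
theorem convexOn_of_fderiv_monotone {s : Set F} (hs : Convex ℝ s) {q : F → ℝ}
    (hq : ∀ a ∈ s, DifferentiableAt ℝ q a)
    (hmono : ∀ a ∈ s, ∀ b ∈ s, 0 ≤ (fderiv ℝ q b - fderiv ℝ q a) (b - a)) :
    ConvexOn ℝ s q := by
  refine ⟨hs, fun a ha b hb μ ν hμ hν hμν => ?_⟩
  set p : ℝ → F := fun t => a + t • (b - a) with hp
  have hps : ∀ t ∈ Icc (0 : ℝ) 1, p t ∈ s := fun t ht => by
    have := hs ha hb (sub_nonneg.2 ht.2) ht.1 (by ring)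
    convert! this using 1
    simp only [hp]; module
  have hpd : ∀ t, HasDerivAt p (b - a) t := fun t => by
    simpa only [one_smul, id] using ((hasDerivAt_id t).smul_const (b - a)).const_add a
  have hd : ∀ t ∈ Icc (0 : ℝ) 1, HasDerivAt (q ∘ p) (fderiv ℝ q (p t) (b - a)) t := fun t ht =>
    (hq _ (hps t ht)).hasFDerivAt.comp_hasDerivAt t (hpd t)
  have hconv : ConvexOn ℝ (Icc (0 : ℝ) 1) (q ∘ p) := by
    refine MonotoneOn.convexOn_of_deriv (convex_Icc 0 1)
      (fun t ht => (hd t ht).continuousAt.continuousWithinAt)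
      (fun t ht => (hd t (interior_subset ht)).differentiableAt.differentiableWithinAt) ?_
    intro t ht u hu htu
    rw [(hd t (interior_subset ht)).deriv, (hd u (interior_subset hu)).deriv]
    rcases htu.eq_or_lt with rfl | htu
    · exact le_rfl
    have h1 := hmono _ (hps t (interior_subset ht)) _ (hps u (interior_subset hu))
    have h2 : p u - p t = (u - t) • (b - a) := by simp only [hp]; module
    rw [h2, map_smul, smul_eq_mul] at h1
    have h3 := nonneg_of_mul_nonneg_right h1 (sub_pos.2 htu)
    simpa using h3
  have h := hconv.2 (left_mem_Icc.2 zero_le_one) (right_mem_Icc.2 zero_le_one) hμ hν hμν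
  have e0 : p 0 = a := by simp [hp]
  have e1 : p 1 = b := by simp [hp]
  have e2 : p ν = μ • a + ν • b := by
    have : μ = 1 - ν := by linarith
    simp only [hp, this]; module
  simpa [e0, e1, e2] using h

/-- A positive definite second derivative at `0` makes the first derivative strongly monotone
nearby. That gives convexity, and comparison with the point `0`, where the derivative vanishes,
gives growth along rays. -/
theorem exists_isConvexWell [FiniteDimensional ℝ F] {q : F → ℝ} {W : Set F} (hW : W ∈ 𝓝 0)
    (hq : ∀ᶠ a in 𝓝 0, ContDiffAt ℝ ∞ q a) (h0 : q 0 = 0) (hd : fderiv ℝ q 0 = 0)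
    (hpos : ∀ u : F, u ≠ 0 → 0 < fderiv ℝ (fderiv ℝ q) 0 u u) :
    ∃ r, closedBall 0 r ⊆ W ∧ IsConvexWell q r := by
  set B := fderiv ℝ (fderiv ℝ q) 0 with hB
  -- `m` is the minimum of the form on the unit sphere; the sphere is empty only when the space is
  -- zero, and then any `m` serves.
  obtain ⟨m, hm, hmB⟩ : ∃ m > 0, ∀ u : F, m * ‖u‖ ^ 2 ≤ B u u := by
    rcases (sphere (0 : F) 1).eq_empty_or_nonempty with he | hne
    · refine ⟨1, one_pos, fun u => ?_⟩
      have : u = 0 := by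
        by_contra hu
        have : ‖u‖⁻¹ • u ∈ sphere (0 : F) 1 := by
          simp [norm_smul, norm_ne_zero_iff.2 hu]
        simp [he] at this
      simp [this]
    · have hc : Continuous fun u : F => B u u := by fun_prop
      obtain ⟨v, hv, hmin⟩ := (isCompact_sphere (0 : F) 1).exists_isMinOn hne hc.continuousOn
      have hv0 : v ≠ 0 := by rintro rfl; simp at hv
      refine ⟨B v v, hpos v hv0, fun u => ?_⟩
      rcases eq_or_ne u 0 with rfl | hu
      · simp
      have hn : 0 < ‖u‖ := norm_pos_iff.2 hu
      have h1 := hmin (a := ‖u‖⁻¹ • u) (by simp [norm_smul, hn.ne'])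
      simp only [mem_ofPred_eq, map_smul, smul_apply, smul_eq_mul] at h1
      calc B v v * ‖u‖ ^ 2 ≤ (‖u‖⁻¹ * (‖u‖⁻¹ * B u u)) * ‖u‖ ^ 2 := by gcongr
        _ = B u u := by field_simp
  have hstr : HasStrictFDerivAt (fderiv ℝ q) B 0 := by
    have h1 : ContDiffAt ℝ 1 (fderiv ℝ q) 0 :=
      hq.self_of_nhds.fderiv_right (m := 1) (by exact WithTop.coe_le_coe.2 le_top)
    exact h1.hasStrictFDerivAt one_ne_zero
  -- Strict differentiability controls the increments of the derivative over all pairs of nearby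
  -- points. An error of `m / 2` leaves half of the coercivity constant.
  have hlo := hstr.isLittleO.def (half_pos hm)
  rw [nhds_prod_eq] at hlo
  obtain ⟨t, ht, hlo⟩ := mem_prod_self_iff.1 hlo
  obtain ⟨r, hr, hrt⟩ := nhds_basis_closedBall.mem_iff.1 (inter_mem ht (inter_mem hW hq))
  have key : ∀ a ∈ closedBall (0 : F) r, ∀ b ∈ closedBall (0 : F) r,
      m / 2 * ‖b - a‖ ^ 2 ≤ (fderiv ℝ q b - fderiv ℝ q a) (b - a) := by
    intro a ha b hb
    have h1 := hlo (show (b, a) ∈ t ×ˢ t from ⟨(hrt hb).1, (hrt ha).1⟩)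
    rw [mem_ofPred_eq] at h1
    have h2 := (fderiv ℝ q b - fderiv ℝ q a - B (b - a)).le_opNorm (b - a)
    rw [Real.norm_eq_abs] at h2
    have h3 := (abs_le.1 (h2.trans (mul_le_mul_of_nonneg_right h1 (norm_nonneg _)))).1
    rw [sub_apply _ (B (b - a))] at h3
    have h4 := hmB (b - a)
    linarith
  have hsm : ∀ a ∈ closedBall (0 : F) r, ContDiffAt ℝ ∞ q a := fun a ha => (hrt ha).2.2
  have hdiff : ∀ a ∈ closedBall (0 : F) r, DifferentiableAt ℝ q a := fun a ha =>
    (hsm a ha).differentiableAt (by simp)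
  have hmem0 : (0 : F) ∈ closedBall (0 : F) r := mem_closedBall_self hr.le
  have hfp : ∀ a ∈ closedBall (0 : F) r, a ≠ 0 → 0 < fderiv ℝ q a a := by
    intro a ha ha0
    have h1 := key 0 hmem0 a ha
    rw [hd, sub_zero, sub_zero] at h1
    have : 0 < ‖a‖ := norm_pos_iff.2 ha0
    exact lt_of_lt_of_le (by positivity) h1
  refine ⟨r, fun a ha => (hrt ha).2.1, hr, hsm, h0, ?_, hd, ?_, hfp⟩
  · exact convexOn_of_fderiv_monotone (convex_closedBall 0 r) hdiff fun a ha b hb =>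
      le_trans (by positivity) (key a ha b hb)
  · intro a ha ha0
    have hseg : ∀ t ∈ Icc (0 : ℝ) 1, t • a ∈ closedBall (0 : F) r := fun t ht => by
      rw [mem_closedBall_zero_iff] at ha ⊢
      rw [norm_smul, Real.norm_of_nonneg ht.1]
      nlinarith [ht.1, ht.2, norm_nonneg a]
    have hder : ∀ t ∈ Icc (0 : ℝ) 1, HasDerivAt (fun t : ℝ => q (t • a)) (fderiv ℝ q (t • a) a) t :=
      fun t ht => by
        have := (hdiff _ (hseg t ht)).hasFDerivAt.comp_hasDerivAt t
          ((hasDerivAt_id t).smul_const a)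
        rw [one_smul] at this
        exact this
    have hm := strictMonoOn_of_deriv_pos (convex_Icc (0 : ℝ) 1)
      (fun t ht => (hder t ht).continuousAt.continuousWithinAt) fun t ht => by
        have ht' := interior_subset ht
        rw [interior_Icc] at ht
        rw [(hder t ht').deriv]
        have := hfp _ (hseg t ht') (smul_ne_zero ht.1.ne' ha0)
        rw [map_smul, smul_eq_mul] at this
        exact pos_of_mul_pos_right this ht.1.le
    have := hm (left_mem_Icc.2 zero_le_one) (right_mem_Icc.2 zero_le_one) zero_lt_one
    simpa [h0] using this

namespace IsConvexWell

variable {q : F → ℝ} {r ρ : ℝ}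

theorem zero_mem (hq : IsConvexWell q r) : (0 : F) ∈ closedBall (0 : F) r :=
  mem_closedBall_self hq.radius_pos.le

theorem continuousOn (hq : IsConvexWell q r) : ContinuousOn q (closedBall 0 r) := fun a ha =>
  (hq.smooth a ha).continuousAt.continuousWithinAt

theorem nonneg (hq : IsConvexWell q r) {a : F} (ha : a ∈ closedBall (0 : F) r) : 0 ≤ q a := by
  rcases eq_or_ne a 0 with rfl | h
  · exact hq.map_zero.ge
  · exact (hq.pos a ha h).le

theorem zero_mem_sublevel (hq : IsConvexWell q r) (hρ : 0 ≤ ρ) : (0 : F) ∈ sublevel q r ρ :=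
  ⟨hq.zero_mem, by rwa [hq.map_zero]⟩

theorem convex_sublevel (hq : IsConvexWell q r) : Convex ℝ (sublevel q r ρ) :=
  hq.convex.convex_le ρ

theorem isClosed_sublevel (hq : IsConvexWell q r) : IsClosed (sublevel q r ρ) :=
  hq.continuousOn.preimage_isClosed_of_isClosed isClosed_closedBall isClosed_Iic

theorem isCompact_sublevel [FiniteDimensional ℝ F] (hq : IsConvexWell q r) :
    IsCompact (sublevel q r ρ) :=
  (isCompact_closedBall (0 : F) r).of_isClosed_subset hq.isClosed_sublevel fun _ h => h.1

/-- The sublevel sets shrink to the minimum. -/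
theorem exists_sublevel_subset [FiniteDimensional ℝ F] (hq : IsConvexWell q r) {U : Set F}
    (hU : U ∈ 𝓝 0) : ∃ ρ₀ > 0, ∀ ρ < ρ₀, sublevel q r ρ ⊆ U := by
  have hK : IsCompact (closedBall (0 : F) r \ interior U) :=
    (isCompact_closedBall (0 : F) r).diff isOpen_interior
  rcases (closedBall (0 : F) r \ interior U).eq_empty_or_nonempty with he | hne
  · exact ⟨1, one_pos, fun ρ _ a ha => interior_subset (sdiff_eq_empty.1 he ha.1)⟩
  obtain ⟨b, hb, hmin⟩ := hK.exists_isMinOn hne (hq.continuousOn.mono sdiff_subset)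
  have hb0 : b ≠ 0 := by
    rintro rfl
    exact hb.2 (mem_interior_iff_mem_nhds.2 hU)
  refine ⟨q b, hq.pos b hb.1 hb0, fun ρ hρ a ha => ?_⟩
  by_contra haU
  have : q b ≤ q a := hmin ⟨ha.1, fun h => haU (interior_subset h)⟩
  exact absurd (ha.2.trans_lt hρ) this.not_gt

/-- Containment in the open ball keeps the sphere of radius `r` out of the frontier. A point of the
level set is not interior, since convexity and `q 0 = 0` give `q ((1 + t) • a) ≥ (1 + t) ρ`. -/
theorem frontier_sublevel (hq : IsConvexWell q r) (hρ : 0 < ρ)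
    (hball : sublevel q r ρ ⊆ ball 0 r) :
    frontier (sublevel q r ρ) = {a ∈ closedBall 0 r | q a = ρ} := by
  rw [hq.isClosed_sublevel.frontier_eq]
  ext a
  constructor
  · rintro ⟨ha, hi⟩
    refine ⟨ha.1, ha.2.eq_of_not_lt fun hlt => hi ?_⟩
    rw [mem_interior_iff_mem_nhds]
    filter_upwards [(hq.smooth a ha.1).continuousAt.eventually_lt continuousAt_const hlt,
      isOpen_ball.mem_nhds (hball ha)] with b hb hb'
    exact ⟨ball_subset_closedBall hb', hb.le⟩
  · rintro ⟨ha, hρa⟩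
    refine ⟨⟨ha, hρa.le⟩, fun hi => ?_⟩
    have ha0 : a ≠ 0 := by
      rintro rfl
      rw [hq.map_zero] at hρa
      exact hρ.ne hρa
    have hc : Tendsto (fun t : ℝ => (1 + t) • a) (𝓝[>] 0) (𝓝 a) := by
      have : Continuous fun t : ℝ => (1 + t) • a := by fun_prop
      simpa using (this.tendsto 0).mono_left nhdsWithin_le_nhds
    obtain ⟨t, ht, htpos⟩ := ((hc.eventually (mem_interior_iff_mem_nhds.1 hi)).and
      self_mem_nhdsWithin).exists
    have htpos' : (0 : ℝ) < t := htpos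
    have h1 := hq.convex.2 hq.zero_mem ht.1 (show 0 ≤ t / (1 + t) by positivity)
      (show 0 ≤ 1 / (1 + t) by positivity) (by field_simp; ring)
    have h2 : (t / (1 + t)) • (0 : F) + (1 / (1 + t)) • (1 + t) • a = a := by
      rw [smul_zero, zero_add, smul_smul, one_div_mul_cancel (by positivity), one_smul]
    rw [h2, hq.map_zero, hρa] at h1
    have h3 := ht.2
    have h4 : 1 / (1 + t) < 1 := by
      rw [div_lt_one (by positivity)]; linarith
    simp only [smul_eq_mul, mul_zero, zero_add] at h1
    have : 1 / (1 + t) * q ((1 + t) • a) ≤ 1 / (1 + t) * ρ :=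
      mul_le_mul_of_nonneg_left h3 (by positivity)
    nlinarith

/-- A small sublevel set is a disc bounded by the level set. -/
theorem exists_homeomorph_closedBall [FiniteDimensional ℝ F] (hq : IsConvexWell q r) (hρ : 0 < ρ)
    (hball : sublevel q r ρ ⊆ ball 0 r) :
    ∃ Φ : sublevel q r ρ ≃ₜ closedBall (0 : F) 1,
      ∀ a : sublevel q r ρ, q a = ρ ↔ ‖(Φ a : F)‖ = 1 := by
  have hint : (interior (sublevel q r ρ)).Nonempty := by
    refine ⟨0, mem_interior_iff_mem_nhds.2 ?_⟩
    have h0 := hq.zero_mem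
    filter_upwards [(hq.smooth 0 h0).continuousAt.eventually_lt continuousAt_const
      (by rwa [hq.map_zero]), closedBall_mem_nhds (0 : F) hq.radius_pos] with a ha hb
    exact ⟨hb, ha.le⟩
  obtain ⟨e, -, he, hf⟩ := exists_homeomorph_image_eq hq.convex_sublevel hint
    (NormedSpace.isVonNBounded_of_isBounded ℝ (isBounded_closedBall.subset fun _ h => h.1))
    (convex_closedBall (0 : F) 1)
    (by rw [interior_closedBall _ one_ne_zero]; exact ⟨0, mem_ball_self one_pos⟩)
    (NormedSpace.isVonNBounded_closedBall ℝ F 1)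
  rw [hq.isClosed_sublevel.closure_eq, isClosed_closedBall.closure_eq] at he
  rw [hq.frontier_sublevel hρ hball, frontier_closedBall _ one_ne_zero] at hf
  refine ⟨(e.image _).trans (Homeomorph.setCongr he), fun a => ?_⟩
  have h1 : (((e.image _).trans (Homeomorph.setCongr he)) a : F) = e a := rfl
  rw [h1, ← mem_sphere_zero_iff_norm, ← hf, e.injective.mem_set_image]
  exact ⟨fun h => ⟨a.2.1, h⟩, fun h => h.2⟩

end IsConvexWell

end ConvexWell

/-! ### The descending flow of a well -/

section Flow

variable {F : Type*} [NormedAddCommGroup F] [NormedSpace ℝ F]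

/-- A bounded Lipschitz vector field is complete. -/
theorem exists_global_integral_curve [CompleteSpace F] {v : F → F} {K : NNReal}
    (hv : LipschitzWith K v) {M : NNReal} (hM : ∀ a, ‖v a‖ ≤ M) (a : F) :
    ∃ η : ℝ → F, η 0 = a ∧ ∀ t, HasDerivAt η (v (η t)) t := by
  have hloc : ∀ T : ℝ, ∃ η : ℝ → F, η 0 = a ∧ ∀ t ∈ Ioo (-T) T, HasDerivAt η (v (η t)) t := by
    intro T
    rcases le_or_gt T 0 with hT | hT
    · exact ⟨fun _ => a, rfl, fun t ht => by linarith [ht.1, ht.2]⟩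
    have h0 : (0 : ℝ) ∈ Icc (-T) T := ⟨by linarith, hT.le⟩
    -- The radius `M T` is the distance covered at speed `M`, so a single Picard–Lindelöf step spans
    -- all of `[-T, T]`.
    have hPL : IsPicardLindelof (fun _ => v) (⟨0, h0⟩ : Icc (-T) T) a (M * T.toNNReal) 0 M K := by
      refine IsPicardLindelof.of_time_independent (fun b _ => hM b) hv.lipschitzOnWith ?_
      simp [hT.le]
    obtain ⟨η, hη0, hη⟩ := hPL.exists_eq_forall_mem_Icc_hasDerivWithinAt₀
    exact ⟨η, hη0, fun t ht => (hη t (Ioo_subset_Icc_self ht)).hasDerivAt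
      (Icc_mem_nhds ht.1 ht.2)⟩
  choose η hη0 hη using hloc
  have huniq : ∀ T T' : ℝ, T ≤ T' → EqOn (η T) (η T') (Ioo (-T) T) := by
    intro T T' hTT' t ht
    exact ODE_solution_unique_of_mem_Ioo (v := fun _ => v) (s := fun _ => univ) (K := K)
      (t₀ := 0) (fun _ _ => hv.lipschitzOnWith) ⟨by linarith [ht.1, ht.2], by linarith [ht.1, ht.2]⟩
      (fun u hu => ⟨hη T u hu, mem_univ _⟩)
      (fun u hu => ⟨hη T' u ⟨by linarith [hu.1], by linarith [hu.2]⟩, mem_univ _⟩)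
      (by rw [hη0, hη0]) ht
  -- The local solutions agree by uniqueness; `|t| + 1` picks one defined around `t`.
  refine ⟨fun t => η (|t| + 1) t, hη0 _, fun t => ?_⟩
  have hmem : t ∈ Ioo (-(|t| + 1)) (|t| + 1) :=
    ⟨by linarith [neg_abs_le t], by linarith [le_abs_self t]⟩
  refine (hη (|t| + 1) t hmem).congr_of_eventuallyEq ?_
  filter_upwards [Ioo_mem_nhds hmem.1 hmem.2] with u hu
  rcases le_total |t| |u| with h | h
  · exact (huniq _ _ (by linarith) hu).symm
  · exact huniq _ _ (by linarith) ⟨by linarith [neg_abs_le u], by linarith [le_abs_self u]⟩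

/-- Used for contradiction in both time directions: a trajectory along which the well changes at a
definite rate cannot keep its values bounded. -/
theorem exists_gt_of_deriv_ge {R R' : ℝ → ℝ} {δ : ℝ} (hδ : 0 < δ)
    (hR : ∀ s, 0 ≤ s → HasDerivAt R (R' s) s) (hR' : ∀ s, 0 ≤ s → δ ≤ R' s) (C : ℝ) :
    ∃ s, 0 ≤ s ∧ C < R s := by
  set s := (|C - R 0| + 1) / δ with hs
  have hs0 : 0 ≤ s := by positivity
  refine ⟨s, hs0, ?_⟩
  have h := (convex_Ici (0 : ℝ)).mul_sub_le_image_sub_of_le_deriv (f := R) (C := δ)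
    (fun u hu => (hR u hu).continuousAt.continuousWithinAt)
    (fun u hu => (hR u (interior_subset hu)).differentiableAt.differentiableWithinAt)
    (fun u hu => by
      rw [(hR u (interior_subset hu)).deriv]; exact hR' u (interior_subset hu))
    0 (mem_Ici.2 le_rfl) s hs0 hs0
  have h2 : δ * (s - 0) = |C - R 0| + 1 := by rw [hs]; field_simp; ring
  linarith [le_abs_self (C - R 0)]

namespace IsConvexWell

variable {q : F → ℝ} {r ρ : ℝ} {Y : F → F}

/-- A vector field on the ball, cut off so that it becomes complete. -/
theorem exists_flow [FiniteDimensional ℝ F] (hr : 0 < r)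
    (hY : ∀ a ∈ closedBall (0 : F) r, ContDiffAt ℝ 1 Y a) (hY0 : Y 0 = 0) :
    ∃ η : F → ℝ → F, (∀ a, η a 0 = a) ∧ (∀ a, Continuous (η a)) ∧
      (∀ a t, η a t ∈ closedBall (0 : F) (r / 2) → HasDerivAt (η a) (-Y (η a t)) t) ∧
      (∀ a s t, η (η a s) t = η a (s + t)) ∧ ∀ t, η 0 t = 0 := by
  -- The cutoff is `1` on the ball of radius `r / 2`, so only there is the flow that of `-Y`. This
  -- is why transport asks the sublevel set to lie in the half ball.
  let χ : ContDiffBump (0 : F) := ⟨r / 2, r, by positivity, by linarith⟩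
  set v : F → F := fun a => χ a • -Y a with hv
  have hsupp : ∀ a ∉ closedBall (0 : F) r, v a = 0 := fun a ha => by
    have : χ a = 0 := χ.zero_of_le_dist (by
      rw [mem_closedBall, not_le] at ha; exact ha.le)
    simp [hv, this]
  have hC : ContDiff ℝ 1 v := by
    rw [contDiff_iff_contDiffAt]
    intro a
    by_cases ha : a ∈ closedBall (0 : F) r
    · exact χ.contDiff.contDiffAt.smul (hY a ha).neg
    · refine (contDiffAt_const (c := (0 : F))).congr_of_eventuallyEq ?_
      filter_upwards [isClosed_closedBall.isOpen_compl.mem_nhds ha] with b hb using hsupp b hb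
  have hcs : HasCompactSupport v := HasCompactSupport.intro (isCompact_closedBall (0 : F) r) hsupp
  obtain ⟨K, hK⟩ := ContDiff.lipschitzWith_of_hasCompactSupport (𝕂 := ℝ) hcs hC one_ne_zero
  obtain ⟨M, hM⟩ := hcs.exists_bound_of_continuous hC.continuous
  have hM' : ∀ a, ‖v a‖ ≤ M.toNNReal := fun a => (hM a).trans (Real.le_coe_toNNReal M)
  have : CompleteSpace F := FiniteDimensional.complete ℝ F
  choose η hη0 hη using exists_global_integral_curve hK hM'
  have huniq : ∀ {f g : ℝ → F}, (∀ t, HasDerivAt f (v (f t)) t) →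
      (∀ t, HasDerivAt g (v (g t)) t) → f 0 = g 0 → f = g := fun hf hg h0 =>
    ODE_solution_unique_univ (v := fun _ => v) (s := fun _ => univ) (K := K) (t₀ := 0)
      (fun _ => hK.lipschitzOnWith) (fun t => ⟨hf t, mem_univ _⟩) (fun t => ⟨hg t, mem_univ _⟩) h0
  refine ⟨η, hη0, fun a => continuous_iff_continuousAt.2 fun t => (hη a t).continuousAt, ?_, ?_, ?_⟩
  · intro a t ht
    have h1 : χ (η a t) = 1 := χ.one_of_mem_closedBall ht
    simpa [hv, h1] using hη a t
  · intro a s t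
    refine congrFun (huniq (f := η (η a s)) (g := fun t => η a (s + t)) (hη _) (fun t => ?_) ?_) t
    · simpa using (hη a (s + t)).comp_const_add s t
    · simp [hη0]
  · intro t
    refine congrFun (huniq (f := η 0) (g := fun _ => 0) (hη _) (fun t => ?_) (hη0 0)) t
    simpa [hv, hY0] using hasDerivAt_const t (0 : F)

/-- The descending flow of a field along which the well increases, parametrized by the values of
the well: it carries the level set to the lower level sets and sweeps out the sublevel set. -/
theorem exists_transport [FiniteDimensional ℝ F] (hq : IsConvexWell q r) (hρ : 0 < ρ)
    (hsub : sublevel q r ρ ⊆ ball 0 (r / 2))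
    (hY : ∀ a ∈ closedBall (0 : F) r, ContDiffAt ℝ 1 Y a) (hY0 : Y 0 = 0)
    (hpos : ∀ a ∈ closedBall (0 : F) r, a ≠ 0 → 0 < fderiv ℝ q a (Y a)) :
    ∃ T : ℝ → F → F,
      (∀ a ∈ sublevel q r ρ, q a = ρ → T 0 a = a ∧ ∀ t ∈ Ico (0 : ℝ) 1,
        T t a ∈ sublevel q r ρ ∧ q (T t a) = (1 - t) * ρ ∧
        ∃ l : ℝ, HasDerivWithinAt (fun t => T t a) (l • Y (T t a)) (Ico 0 1) t) ∧
      ∀ p ∈ sublevel q r ρ, p ≠ 0 →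
        ∃ a ∈ sublevel q r ρ, q a = ρ ∧ ∃ t ∈ Ico (0 : ℝ) 1, T t a = p := by
  obtain ⟨η, hη0, hηc, hηd, hηs, hηz⟩ := exists_flow hq.radius_pos hY hY0
  have hr := hq.radius_pos
  have hhalf : closedBall (0 : F) (r / 2) ⊆ closedBall 0 r := closedBall_subset_closedBall (by linarith)
  have hSh : sublevel q r ρ ⊆ closedBall 0 (r / 2) := hsub.trans ball_subset_closedBall
  have hder : ∀ a t, η a t ∈ closedBall (0 : F) (r / 2) →
      HasDerivAt (fun t => q (η a t)) (-fderiv ℝ q (η a t) (Y (η a t))) t := fun a t ht => by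
    have := ((hq.smooth _ (hhalf ht)).differentiableAt (by simp)).hasFDerivAt.comp_hasDerivAt t
      (hηd a t ht)
    rw [map_neg] at this
    exact this
  have hnn : ∀ a ∈ closedBall (0 : F) r, 0 ≤ fderiv ℝ q a (Y a) := fun a ha => by
    rcases eq_or_ne a 0 with rfl | h
    · simp [hY0]
    · exact (hpos a ha h).le
  have hne : ∀ a t, a ≠ 0 → η a t ≠ 0 := fun a t ha h => by
    have h1 := hηs a t (-t)
    rw [h, hηz, add_neg_cancel, hη0] at h1
    exact ha h1.symm
  -- Continuous induction on time: the sublevel set lies in the open half ball, so the curve stays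
  -- there a little longer, and meanwhile `q` does not increase.
  have hfwd : ∀ a ∈ sublevel q r ρ, ∀ s, 0 ≤ s → η a s ∈ sublevel q r ρ := by
    intro a ha s hs
    have hcl : IsClosed ({u | η a u ∈ sublevel q r ρ} ∩ Icc 0 s) :=
      (hq.isClosed_sublevel.preimage (hηc a)).inter isClosed_Icc
    refine hcl.Icc_subset_of_forall_exists_gt (by simpa [hη0] using ha) ?_ ⟨hs, le_rfl⟩
    rintro u ⟨hu, -⟩ y (hy : u < y)
    have hev := (hηc a).continuousAt.eventually (isOpen_ball.mem_nhds (hsub hu))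
    obtain ⟨ε, hε, hball⟩ := Metric.eventually_nhds_iff_ball.1 hev
    set w := min y (u + ε / 2) with hw
    have huw : u < w := lt_min hy (by linarith)
    have hin : ∀ z ∈ Icc u w, η a z ∈ closedBall (0 : F) (r / 2) := fun z hz =>
      ball_subset_closedBall (hball z (by
        rw [mem_ball, Real.dist_eq, abs_lt]
        constructor <;> linarith [hz.1, hz.2, min_le_right y (u + ε / 2)]))
    have hanti := antitoneOn_of_deriv_nonpos (convex_Icc u w)
      (fun z hz => (hder a z (hin z hz)).continuousAt.continuousWithinAt)
      (fun z hz => (hder a z (hin z (interior_subset hz))).differentiableAt.differentiableWithinAt)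
      (fun z hz => by
        rw [(hder a z (hin z (interior_subset hz))).deriv]
        linarith [hnn _ (hhalf (hin z (interior_subset hz)))])
    exact ⟨w, ⟨hhalf (hin w (right_mem_Icc.2 huw.le)),
      (hanti (left_mem_Icc.2 huw.le) (right_mem_Icc.2 huw.le) huw.le).trans hu.2⟩,
      huw, min_le_left _ _⟩
  have hlow : ∀ ε > 0, ∃ δ > 0, ∀ a ∈ sublevel q r ρ, ε ≤ q a → δ ≤ fderiv ℝ q a (Y a) := by
    intro ε hε
    have hK : IsCompact (sublevel q r ρ ∩ {a | a ∈ closedBall 0 r ∧ q a ∈ Ici ε}) :=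
      hq.isCompact_sublevel.inter_right
        (hq.continuousOn.preimage_isClosed_of_isClosed isClosed_closedBall isClosed_Ici)
    rcases (sublevel q r ρ ∩ {a | a ∈ closedBall 0 r ∧ q a ∈ Ici ε}).eq_empty_or_nonempty
      with he | hn
    · exact ⟨1, one_pos, fun a ha hεa => (he.le ⟨ha, ha.1, hεa⟩ : a ∈ (∅ : Set F)).elim⟩
    have hcont : ContinuousOn (fun a => fderiv ℝ q a (Y a)) (closedBall 0 r) := fun a ha =>
      (((hq.smooth a ha).continuousAt_fderiv (by simp)).clm_apply
        (hY a ha).continuousAt).continuousWithinAt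
    obtain ⟨b, hb, hmin⟩ := hK.exists_isMinOn hn (hcont.mono fun a ha => ha.1.1)
    have hb0 : b ≠ 0 := by
      rintro rfl
      have : ε ≤ q 0 := hb.2.2
      rw [hq.map_zero] at this
      exact this.not_gt hε
    exact ⟨_, hpos b hb.1.1 hb0, fun a ha hεa => hmin ⟨ha, ha.1, hεa⟩⟩
  have hdec : ∀ a ∈ sublevel q r ρ, ∀ ε > 0, ∃ s, 0 ≤ s ∧ q (η a s) < ε := by
    intro a ha ε hε
    by_contra! hcon
    obtain ⟨δ, hδ, hδq⟩ := hlow ε hε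
    obtain ⟨s, hs, hs'⟩ := exists_gt_of_deriv_ge hδ
      (fun s hs => (hder a s (hSh (hfwd a ha s hs))).neg)
      (fun s hs => by rw [neg_neg]; exact hδq _ (hfwd a ha s hs) (hcon s hs)) 0
    have : 0 < -q (η a s) := hs'
    linarith [hcon s hs]
  have hanti : ∀ a ∈ sublevel q r ρ, a ≠ 0 → StrictAntiOn (fun s => q (η a s)) (Ici 0) := by
    intro a ha ha0
    refine strictAntiOn_of_deriv_neg (convex_Ici 0)
      (fun s hs => (hder a s (hSh (hfwd a ha s hs))).continuousAt.continuousWithinAt) fun s hs => ?_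
    have hmem := hfwd a ha s (interior_subset hs)
    rw [(hder a s (hSh hmem)).deriv]
    linarith [hpos _ hmem.1 (hne a s ha0)]
  have hlvl : ∀ a t, ∃ s, a ∈ sublevel q r ρ → q a = ρ → t ∈ Ico (0 : ℝ) 1 →
      0 ≤ s ∧ q (η a s) = (1 - t) * ρ := by
    intro a t
    by_cases h : a ∈ sublevel q r ρ ∧ q a = ρ ∧ t ∈ Ico (0 : ℝ) 1
    · obtain ⟨ha, haρ, ht⟩ := h
      obtain ⟨s₁, hs₁, hlt⟩ := hdec a ha ((1 - t) * ρ) (mul_pos (sub_pos.2 ht.2) hρ)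
      have hc : ContinuousOn (fun s => q (η a s)) (Icc 0 s₁) := fun s hs =>
        (hder a s (hSh (hfwd a ha s hs.1))).continuousAt.continuousWithinAt
      obtain ⟨s, hs, hs'⟩ := intermediate_value_Icc' hs₁ hc
        (show (1 - t) * ρ ∈ Icc (q (η a s₁)) (q (η a 0)) from
          ⟨hlt.le, by rw [hη0, haρ]; nlinarith [ht.1]⟩)
      exact ⟨s, fun _ _ _ => ⟨hs.1, hs'⟩⟩
    · exact ⟨0, fun h1 h2 h3 => absurd ⟨h1, h2, h3⟩ h⟩
  choose s hs using hlvl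
  have hne0 : ∀ a, q a = ρ → a ≠ 0 := by
    rintro a ha rfl
    rw [hq.map_zero] at ha
    exact hρ.ne ha
  refine ⟨fun t a => η a (s a t), fun a ha haρ => ⟨?_, fun t ht => ?_⟩, fun p hp hp0 => ?_⟩
  · have h0 := hs a 0 ha haρ ⟨le_rfl, one_pos⟩
    have h1 : s a 0 = 0 := (hanti a ha (hne0 a haρ)).injOn (mem_Ici.2 h0.1) (mem_Ici.2 le_rfl)
      (by simp only [h0.2, hη0, haρ]; ring)
    simp only [h1, hη0]
  · have hst := hs a t ha haρ ht
    have hmem := hfwd a ha _ hst.1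
    refine ⟨hmem, hst.2, ?_⟩
    have hA := hanti a ha (hne0 a haρ)
    -- The hitting time inverts a strictly decreasing function, so bounds on it can be read off from
    -- values of `q`.
    have hcont : Tendsto (s a) (𝓝[Ico 0 1] t) (𝓝 (s a t)) := by
      refine tendsto_order.2 ⟨fun c hc => ?_, fun c hc => ?_⟩
      · rcases lt_or_ge c 0 with hc0 | hc0
        · filter_upwards [self_mem_nhdsWithin] with u hu
          exact hc0.trans_le (hs a u ha haρ hu).1
        have h1 : (1 - t) * ρ < q (η a c) := hst.2 ▸ hA hc0 hst.1 hc
        have h2 : ∀ᶠ u in 𝓝 t, (1 - u) * ρ < q (η a c) :=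
          (by fun_prop : Continuous fun u : ℝ => (1 - u) * ρ).continuousAt.eventually_lt
            continuousAt_const h1
        filter_upwards [self_mem_nhdsWithin, nhdsWithin_le_nhds h2] with u hu hu2
        have h3 := hs a u ha haρ hu
        rw [← h3.2] at hu2
        exact (hA.lt_iff_gt h3.1 hc0).1 hu2
      · have hc0 : 0 ≤ c := hst.1.trans hc.le
        have h1 : q (η a c) < (1 - t) * ρ := hst.2 ▸ hA hst.1 hc0 hc
        have h2 : ∀ᶠ u in 𝓝 t, q (η a c) < (1 - u) * ρ :=
          continuousAt_const.eventually_lt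
            (by fun_prop : Continuous fun u : ℝ => (1 - u) * ρ).continuousAt h1
        filter_upwards [self_mem_nhdsWithin, nhdsWithin_le_nhds h2] with u hu hu2
        have h3 := hs a u ha haρ hu
        rw [← h3.2] at hu2
        exact (hA.lt_iff_gt hc0 h3.1).1 hu2
    have hd1 := ((hder a _ (hSh hmem)).div_const ρ).const_sub 1
    have hd0 : -(-fderiv ℝ q (η a (s a t)) (Y (η a (s a t))) / ρ) ≠ 0 := by
      have := hpos _ hmem.1 (hne a (s a t) (hne0 a haρ))
      rw [neg_div, neg_neg]
      positivity
    have hinv : ∀ᶠ u in 𝓝[Ico 0 1] t, 1 - q (η a (s a u)) / ρ = u := by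
      filter_upwards [self_mem_nhdsWithin] with u hu
      rw [(hs a u ha haρ hu).2]
      field_simp
      ring
    -- Inverse function rule in one variable: `1 - q / ρ` along the flow has derivative `dq(Y) / ρ ≠
    -- 0`, and `s a` is its inverse.
    have hsd : DifferentiableWithinAt ℝ (s a) (Ico 0 1) t :=
      (HasFDerivWithinAt.of_local_left_inverse (t := univ) (by rwa [nhdsWithin_univ])
        (hd1.hasFDerivAt_equiv hd0).hasFDerivWithinAt ht hinv).differentiableWithinAt
    refine ⟨-derivWithin (s a) (Ico 0 1) t, ?_⟩
    have := (hηd a _ (hSh hmem)).scomp_hasDerivWithinAt t hsd.hasDerivWithinAt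
    rw [smul_neg, ← neg_smul] at this
    exact this
  -- Backwards in time, a curve that never met the level `ρ` would stay in the sublevel set with `q
  -- ≥ q p > 0`. There `dq(Y)` is bounded below, so `q` would exceed `ρ`.
  · have hback : ∃ u, 0 ≤ u ∧ η p (-u) ∈ sublevel q r ρ ∧ q (η p (-u)) = ρ := by
      by_contra! hcon
      have hin : ∀ u, 0 ≤ u → η p (-u) ∈ sublevel q r ρ := by
        intro u hu
        have hcl : IsClosed ({u | η p (-u) ∈ sublevel q r ρ} ∩ Icc 0 u) :=
          (hq.isClosed_sublevel.preimage ((hηc p).comp continuous_neg)).inter isClosed_Icc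
        refine hcl.Icc_subset_of_forall_exists_gt (by simpa [hη0] using hp) ?_ ⟨hu, le_rfl⟩
        rintro z ⟨hz, hz0, -⟩ y (hy : z < y)
        have hlt : q (η p (-z)) < ρ := lt_of_le_of_ne hz.2 (hcon z hz0 hz)
        have hev : ∀ᶠ b in 𝓝 (η p (-z)), b ∈ sublevel q r ρ := by
          filter_upwards [isOpen_ball.mem_nhds (hsub hz),
            (hq.smooth _ hz.1).continuousAt.eventually_lt continuousAt_const hlt] with b hb hb'
          exact ⟨hhalf (ball_subset_closedBall hb), hb'.le⟩
        have hev' := ((hηc p).comp continuous_neg).continuousAt.eventually hev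
        obtain ⟨w, hw, hw'⟩ := ((eventually_nhdsWithin_of_eventually_nhds hev').and
          (Ioc_mem_nhdsGT hy)).exists
        exact ⟨w, hw, hw'⟩
      have hd : ∀ u, 0 ≤ u → HasDerivAt (fun u => q (η p (-u)))
          (fderiv ℝ q (η p (-u)) (Y (η p (-u)))) u := fun u hu => by
        have := (hder p (-u) (hSh (hin u hu))).scomp u (hasDerivAt_neg u)
        rw [neg_smul, one_smul, neg_neg] at this
        exact this
      have hmono : MonotoneOn (fun u => q (η p (-u))) (Ici 0) :=
        monotoneOn_of_deriv_nonneg (convex_Ici 0)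
          (fun u hu => (hd u hu).continuousAt.continuousWithinAt)
          (fun u hu => (hd u (interior_subset hu)).differentiableAt.differentiableWithinAt)
          (fun u hu => by
            rw [(hd u (interior_subset hu)).deriv]
            exact hnn _ (hin u (interior_subset hu)).1)
      obtain ⟨δ, hδ, hδq⟩ := hlow (q p) (hq.pos p hp.1 hp0)
      obtain ⟨u, hu, hu'⟩ := exists_gt_of_deriv_ge hδ hd
        (fun u hu => hδq _ (hin u hu) (by
          have := hmono (mem_Ici.2 le_rfl) (mem_Ici.2 hu) hu
          simpa [hη0] using this)) ρ
      exact hu'.not_ge (hin u hu).2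
    obtain ⟨u, hu, hmem, huρ⟩ := hback
    have hp' : η (η p (-u)) u = p := by rw [hηs, neg_add_cancel, hη0]
    have hqp := hq.pos p hp.1 hp0
    have ht : 1 - q p / ρ ∈ Ico (0 : ℝ) 1 :=
      ⟨sub_nonneg.2 ((div_le_one hρ).2 hp.2), by linarith [div_pos hqp hρ]⟩
    refine ⟨η p (-u), hmem, huρ, 1 - q p / ρ, ht, ?_⟩
    have h1 := hs _ _ hmem huρ ht
    have h2 : s (η p (-u)) (1 - q p / ρ) = u :=
      (hanti _ hmem (hne0 _ huρ)).injOn (mem_Ici.2 h1.1) (mem_Ici.2 hu) (by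
        simp only [h1.2, hp']
        field_simp
        ring)
    simp only [h2, hp']

end IsConvexWell

end Flow

/-! ### Straightening a function at a regular point -/

section LevelChart

variable {F : Type*} [NormedAddCommGroup F] [NormedSpace ℝ F]

/-- A smooth function becomes affine in a suitable chart at a regular point. -/
theorem exists_level_chart [CompleteSpace F] {q : F → ℝ} {a₀ : F} {U : Set F} (hU : IsOpen U)
    (haU : a₀ ∈ U) (hq : ContDiffOn ℝ ∞ q U) (hd : fderiv ℝ q a₀ ≠ 0) :
    ∃ e : OpenPartialHomeomorph F F, a₀ ∈ e.source ∧ e.source ⊆ U ∧ e a₀ = 0 ∧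
      (∀ a ∈ e.source, fderiv ℝ q a₀ (e a) = q a - q a₀) ∧ ContDiffOn ℝ ∞ e.symm e.target ∧
      ∀ b ∈ e.target, Function.Injective (fderiv ℝ e.symm b) := by
  set ℓ := fderiv ℝ q a₀ with hℓ
  obtain ⟨w, hw⟩ : ∃ w, ℓ w = 1 := by
    obtain ⟨u, hu⟩ : ∃ u, ℓ u ≠ 0 := by
      by_contra! h
      exact hd (ContinuousLinearMap.ext h)
    exact ⟨(ℓ u)⁻¹ • u, by simp [hu]⟩
  -- The nonlinear part of `q` is added in a direction `w` with `ℓ w = 1`. So `ℓ ∘ Ψ = q - q a₀`,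
  -- while the derivative at `a₀` remains the identity.
  set Ψ : F → F := fun a => (a - a₀) + (q a - q a₀ - ℓ (a - a₀)) • w with hΨ
  have hqa : ∀ a ∈ U, ContDiffAt ℝ ∞ q a := fun a ha => hq.contDiffAt (hU.mem_nhds ha)
  have hΨs : ∀ a ∈ U, ContDiffAt ℝ ∞ Ψ a := fun a ha => by
    have := hqa a ha
    fun_prop
  have hΨd : HasFDerivAt Ψ ((ContinuousLinearEquiv.refl ℝ F : F ≃L[ℝ] F) : F →L[ℝ] F) a₀ := by
    have h1 : HasFDerivAt q ℓ a₀ := ((hqa a₀ haU).differentiableAt (by simp)).hasFDerivAt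
    have h2 : HasFDerivAt (fun a : F => a - a₀) (ContinuousLinearMap.id ℝ F) a₀ :=
      (hasFDerivAt_id a₀).sub_const a₀
    have h3 := h2.add (((h1.sub_const (q a₀)).sub (ℓ.hasFDerivAt.comp a₀ h2)).smul_const w)
    convert! h3 using 1
    ext v
    simp
  set e₀ := (hΨs a₀ haU).toOpenPartialHomeomorph Ψ hΨd (by simp) with he₀
  have hcont : ContinuousAt (fderiv ℝ Ψ) a₀ := (hΨs a₀ haU).continuousAt_fderiv (by simp)
  -- Invertible operators form an open set; shrinking the chart to where the derivative is
  -- invertible makes its inverse smooth and immersive on the whole target.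
  have hinv : ∀ᶠ a in 𝓝 a₀, fderiv ℝ Ψ a ∈ range ((↑) : (F ≃L[ℝ] F) → F →L[ℝ] F) := by
    refine hcont.eventually ?_
    rw [hΨd.fderiv]
    exact (ContinuousLinearEquiv.refl ℝ F).nhds
  obtain ⟨O, hO, hOo, haO⟩ := _root_.mem_nhds_iff.1 (inter_mem hinv (hU.mem_nhds haU))
  set e := e₀.restrOpen O hOo with he
  have hsrc : e.source = e₀.source ∩ O := rfl
  have hmem : a₀ ∈ e.source :=
    ⟨ContDiffAt.mem_toOpenPartialHomeomorph_source (hΨs a₀ haU) hΨd (by simp), haO⟩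
  have hcoe : ∀ a, e a = Ψ a := fun a => rfl
  have hsymm : ∀ b ∈ e.target, ∃ f' : F ≃L[ℝ] F, HasFDerivAt e (f' : F →L[ℝ] F) (e.symm b) ∧
      ContDiffAt ℝ ∞ e (e.symm b) := fun b hb => by
    have hs := e.map_target hb
    obtain ⟨f', hf'⟩ := (hO hs.2).1
    have hsm := hΨs _ (hO hs.2).2
    exact ⟨f', hf' ▸ (hsm.differentiableAt (by simp)).hasFDerivAt, hsm⟩
  refine ⟨e, hmem, fun a ha => (hO ha.2).2, by simp [hcoe, hΨ], fun a _ => ?_, fun b hb => ?_,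
    fun b hb => ?_⟩
  · rw [hcoe, hΨ]
    simp [hw]
  · obtain ⟨f', hf', hs⟩ := hsymm b hb
    exact (e.contDiffAt_symm hb hf' hs).contDiffWithinAt
  · obtain ⟨f', hf', hs⟩ := hsymm b hb
    rw [(e.hasFDerivAt_symm hb hf').fderiv]
    exact f'.symm.injective

end LevelChart

theorem isEmbedding_domRestrict_comp {X Y Z : Type*} [TopologicalSpace X] [TopologicalSpace Y]
    [TopologicalSpace Z] {g : Y → Z} {f : X → Y} {s : Set X} {t : Set Y}
    (hg : IsEmbedding (t.domRestrict g)) (hf : IsEmbedding (s.domRestrict f)) (hst : MapsTo f s t) :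
    IsEmbedding (s.domRestrict (g ∘ f)) :=
  hg.comp (hf.codRestrict t fun y => hst y.2)

theorem isEmbedding_domRestrict_mono {X Y : Type*} [TopologicalSpace X] [TopologicalSpace Y]
    {f : X → Y} {s t : Set X} (hf : IsEmbedding (t.domRestrict f)) (hst : s ⊆ t) :
    IsEmbedding (s.domRestrict f) :=
  hf.comp (IsEmbedding.inclusion hst)

/-! ### Sublevel and level sets as isotropic submanifolds -/

section Submanifolds

variable {E : Type*} [NormedAddCommGroup E] [NormedSpace ℂ E]
  {N : Type*} [TopologicalSpace N] [ChartedSpace E N] [IsManifold 𝓘(ℂ, E) ω N]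
  {h : HermitianMetric E N} {n : ℕ} {V : Set N} {x : N}
  {W : Set (EuclideanSpace ℝ (Fin n))} {φ : EuclideanSpace ℝ (Fin n) → N}

namespace IsIsotropicParametrization

theorem domain_eq : W ∩ {a | 0 ≤ (0 : EuclideanSpace ℝ (Fin n) →L[ℝ] ℝ) a} = W := by simp

theorem mdifferentiableAt {ℓ} (hφ : IsIsotropicParametrization h n V x ℓ W φ) {a} (ha : a ∈ W) :
    MDifferentiableAt 𝓘(ℝ, EuclideanSpace ℝ (Fin n)) 𝓘(ℝ, E) φ a :=
  ((hφ.smooth a ha).contMDiffAt (hφ.isOpen.mem_nhds ha)).mdifferentiableAt (by simp)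

theorem isEmbedding (hφ : IsIsotropicParametrization h n V x 0 W φ) :
    IsEmbedding (W.domRestrict φ) :=
  isEmbedding_domRestrict_mono hφ.embedding domain_eq.ge

theorem injOn (hφ : IsIsotropicParametrization h n V x 0 W φ) : InjOn φ W :=
  injOn_iff_injective.2 hφ.isEmbedding.injective

theorem exists_image_inter_eq (hφ : IsIsotropicParametrization h n V x 0 W φ)
    {O : Set (EuclideanSpace ℝ (Fin n))} (hO : IsOpen O) :
    ∃ Q : Set N, IsOpen Q ∧ ∀ S ⊆ W, φ '' (S ∩ O) = φ '' S ∩ Q := by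
  obtain ⟨Q, hQ, hQO⟩ := hφ.isEmbedding.isInducing.isOpen_iff.1 (hO.preimage continuous_subtype_val)
  refine ⟨Q, hQ, fun S hS => ?_⟩
  have key : ∀ a ∈ W, φ a ∈ Q ↔ a ∈ O := fun a ha => by
    have := Set.ext_iff.1 hQO ⟨a, ha⟩
    exact this
  ext y
  constructor
  · rintro ⟨a, ⟨ha, haO⟩, rfl⟩
    exact ⟨⟨a, ha, rfl⟩, (key a (hS ha)).2 haO⟩
  · rintro ⟨⟨a, ha, rfl⟩, hy⟩
    exact ⟨a, ⟨ha, (key a (hS ha)).1 hy⟩, rfl⟩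

/-- A subset of an isotropic submanifold is parametrized through a chart of the submanifold. -/
theorem comp (hφ : IsIsotropicParametrization h n V x 0 W φ) {k : ℕ}
    {ℓ : EuclideanSpace ℝ (Fin k) →L[ℝ] ℝ} {W' : Set (EuclideanSpace ℝ (Fin k))}
    {χ : EuclideanSpace ℝ (Fin k) → EuclideanSpace ℝ (Fin n)}
    {S : Set (EuclideanSpace ℝ (Fin n))} (hS : S ⊆ W)
    (hW' : IsOpen W') (h0 : 0 ∈ W') (hχ : ContDiffOn ℝ ∞ χ W') (hmaps : MapsTo χ W' W)
    (hinj : ∀ b ∈ W', Function.Injective (fderiv ℝ χ b))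
    (hemb : IsEmbedding ((W' ∩ {a | 0 ≤ ℓ a}).domRestrict χ))
    (himg : ∃ O, IsOpen O ∧ χ '' (W' ∩ {a | 0 ≤ ℓ a}) = S ∩ O) :
    IsIsotropicParametrization h k (φ '' S) (φ (χ 0)) ℓ W' (φ ∘ χ) := by
  have hd : ∀ b ∈ W', HasMFDerivAt 𝓘(ℝ, EuclideanSpace ℝ (Fin k)) 𝓘(ℝ, E) (φ ∘ χ) b
      ((mfderiv 𝓘(ℝ, EuclideanSpace ℝ (Fin n)) 𝓘(ℝ, E) φ (χ b)).comp (fderiv ℝ χ b)) :=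
    fun b hb => by
    have h1 : HasFDerivAt χ (fderiv ℝ χ b) b :=
      (((hχ b hb).contDiffAt (hW'.mem_nhds hb)).differentiableAt (by simp)).hasFDerivAt
    exact (hφ.mdifferentiableAt (hmaps hb)).hasMFDerivAt.comp b h1.hasMFDerivAt
  refine ⟨hW', h0, rfl, hφ.smooth.comp hχ.contMDiffOn hmaps, fun b hb _ => ?_, ?_, ?_,
    fun b hb _ u v => ?_⟩
  · rw [(hd b hb).mfderiv]
    exact (hφ.immersion _ (hmaps hb) le_rfl).comp (hinj b hb)
  · exact isEmbedding_domRestrict_comp hφ.isEmbedding hemb fun b hb => hmaps hb.1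
  · obtain ⟨O, hO, hO'⟩ := himg
    obtain ⟨Q, hQ, hQ'⟩ := hφ.exists_image_inter_eq hO
    exact ⟨Q, hQ, by rw [image_comp, hO', hQ' S hS]⟩
  · rw [(hd b hb).mfderiv]
    exact hφ.isotropic _ (hmaps hb) le_rfl _ _

variable {q : EuclideanSpace ℝ (Fin n) → ℝ} {r ρ : ℝ}

/-- Translations parametrize near points with `q < ρ`. Where `q = ρ`, the derivative of `q` is
nonzero, and in the level chart the condition `q ≤ ρ` is the half-space `-dq ≥ 0`. -/
theorem isotropic_sublevel (hφ : IsIsotropicParametrization h n V x 0 W φ)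
    (hq : IsConvexWell q r) (hW : closedBall 0 r ⊆ W) (hρ : 0 < ρ)
    (hsub : sublevel q r ρ ⊆ ball 0 r) :
    IsIsotropicSubmanifoldWithBoundary h n (φ '' sublevel q r ρ) := by
  have hSW : sublevel q r ρ ⊆ W := fun a ha => hW ha.1
  have hsm : ContDiffOn ℝ ∞ q (ball 0 r) := fun a ha =>
    (hq.smooth a (ball_subset_closedBall ha)).contDiffWithinAt
  rintro _ ⟨a, ha, rfl⟩
  rcases ha.2.lt_or_eq with hlt | heq
  · have hO : IsOpen (ball 0 r ∩ q ⁻¹' Iio ρ) :=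
      hsm.continuousOn.isOpen_inter_preimage isOpen_ball isOpen_Iio
    set O := ball 0 r ∩ q ⁻¹' Iio ρ with hOdef
    have hOS : O ⊆ sublevel q r ρ := fun b hb => ⟨ball_subset_closedBall hb.1, le_of_lt hb.2⟩
    have haO : a ∈ O := ⟨hsub ha, hlt⟩
    have hres := hφ.comp (k := n) (ℓ := 0) (W' := (fun b => a + b) ⁻¹' O) (χ := fun b => a + b)
      hSW (hO.preimage (by fun_prop)) (by simpa using haO) (by fun_prop)
      (fun b hb => hSW (hOS hb)) (fun b _ => by
        rw [fderiv_const_add, fderiv_fun_id]; exact fun _ _ h => h)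
      ((Homeomorph.addLeft a).isEmbedding.comp IsEmbedding.subtypeVal)
      ⟨O, hO, by
        rw [domain_eq, image_preimage_eq O (f := fun b => a + b) (Homeomorph.addLeft a).surjective,
          inter_eq_right.2 hOS]⟩
    exact ⟨0, _, _, by simpa using hres⟩
  · have ha0 : a ≠ 0 := by
      rintro rfl
      rw [hq.map_zero] at heq
      exact hρ.ne heq
    have hd : fderiv ℝ q a ≠ 0 := fun h0 => by
      have := hq.fderiv_pos a ha.1 ha0
      simp [h0] at this
    obtain ⟨e, hae, heU, he0, hel, hes, hei⟩ := exists_level_chart isOpen_ball (hsub ha) hsm hd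
    have h0t : (0 : EuclideanSpace ℝ (Fin n)) ∈ e.target := he0 ▸ e.map_source hae
    have hres := hφ.comp (k := n) (ℓ := -fderiv ℝ q a) (W' := e.target) (χ := e.symm)
      hSW e.open_target h0t hes
      (fun b hb => hW (ball_subset_closedBall (heU (e.map_target hb)))) hei
      (isEmbedding_domRestrict_mono e.symm.isOpenEmbedding_restrict.isEmbedding inter_subset_left)
      ⟨e.source, e.open_source, by
        ext b
        constructor
        · rintro ⟨c, ⟨hc, hc'⟩, rfl⟩
          have h1 := hel _ (e.map_target hc)
          rw [e.right_inv hc] at h1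
          have h2 : 0 ≤ -(fderiv ℝ q a) c := hc'
          exact ⟨⟨ball_subset_closedBall (heU (e.map_target hc)), by linarith⟩, e.map_target hc⟩
        · rintro ⟨hb, hbs⟩
          refine ⟨e b, ⟨e.map_source hbs, ?_⟩, e.left_inv hbs⟩
          have h2 : 0 ≤ -(fderiv ℝ q a) (e b) := by
            rw [hel b hbs]; linarith [hb.2]
          exact h2⟩
    rw [← he0, e.left_inv hae] at hres
    exact ⟨_, _, _, hres⟩

/-- In the level chart the level set is the hyperplane `ker dq`, which is identified with `ℝⁿ⁻¹`. -/
theorem isotropic_level (hφ : IsIsotropicParametrization h n V x 0 W φ)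
    (hq : IsConvexWell q r) (hW : closedBall 0 r ⊆ W) (hρ : 0 < ρ)
    (hsub : sublevel q r ρ ⊆ ball 0 r) :
    IsIsotropicSubmanifold h (n - 1) (φ '' {a ∈ closedBall 0 r | q a = ρ}) := by
  have hSW : {a ∈ closedBall 0 r | q a = ρ} ⊆ W := fun a ha => hW ha.1
  have hsm : ContDiffOn ℝ ∞ q (ball 0 r) := fun a ha =>
    (hq.smooth a (ball_subset_closedBall ha)).contDiffWithinAt
  rintro _ ⟨a, ⟨ha, heq⟩, rfl⟩
  have ha0 : a ≠ 0 := by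
    rintro rfl
    rw [hq.map_zero] at heq
    exact hρ.ne heq
  have hd : fderiv ℝ q a ≠ 0 := fun h0 => by
    have := hq.fderiv_pos a ha ha0
    simp [h0] at this
  obtain ⟨e, hae, heU, he0, hel, hes, hei⟩ :=
    exists_level_chart isOpen_ball (hsub ⟨ha, heq.le⟩) hsm hd
  have h0t : (0 : EuclideanSpace ℝ (Fin n)) ∈ e.target := he0 ▸ e.map_source hae
  set ℓ := fderiv ℝ q a with hℓ
  -- The truncated subtraction is harmless: a nonzero `ℓ` forces `n ≥ 1`.
  have hrank : Module.finrank ℝ (EuclideanSpace ℝ (Fin (n - 1))) =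
      Module.finrank ℝ (LinearMap.ker (ℓ : EuclideanSpace ℝ (Fin n) →ₗ[ℝ] ℝ)) := by
    have h1 := Module.Dual.finrank_ker_add_one_of_ne_zero
      (f := (ℓ : EuclideanSpace ℝ (Fin n) →ₗ[ℝ] ℝ)) (by
        intro h0; exact hd (ContinuousLinearMap.coe_injective h0))
    rw [finrank_euclideanSpace_fin] at h1 ⊢
    omega
  set j := ContinuousLinearEquiv.ofFinrankEq hrank
  set ι : EuclideanSpace ℝ (Fin (n - 1)) →L[ℝ] EuclideanSpace ℝ (Fin n) :=
    (LinearMap.ker (ℓ : EuclideanSpace ℝ (Fin n) →ₗ[ℝ] ℝ)).subtypeL.comp (j : _ →L[ℝ] _) with hι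
  have hιi : Function.Injective ι := Subtype.val_injective.comp j.injective
  have hιl : ∀ b, ℓ (ι b) = 0 := fun b => (j b).2
  have hιs : ∀ c, ℓ c = 0 → ∃ b, ι b = c := fun c hc =>
    ⟨j.symm ⟨c, hc⟩, by simp [hι]⟩
  have hιe : IsEmbedding ι :=
    (LinearMap.isClosedEmbedding_of_injective (𝕜 := ℝ) (f := ι.toLinearMap)
      (LinearMap.ker_eq_bot.2 hιi)).isEmbedding
  have hres := hφ.comp (k := n - 1) (ℓ := 0) (W' := ι ⁻¹' e.target) (χ := e.symm ∘ ι)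
    hSW (e.open_target.preimage ι.continuous) (by simpa using h0t)
    (hes.comp ι.contDiff.contDiffOn fun b hb => hb)
    (fun b hb => hW (ball_subset_closedBall (heU (e.map_target hb))))
    (fun b hb => by
      have h1 := ((hes _ hb).contDiffAt (e.open_target.mem_nhds hb)).differentiableAt (by simp)
      rw [(h1.hasFDerivAt.comp b ι.hasFDerivAt).fderiv]
      exact (hei _ hb).comp hιi)
    (isEmbedding_domRestrict_comp e.symm.isOpenEmbedding_restrict.isEmbedding
      (hιe.comp IsEmbedding.subtypeVal) fun b hb => hb.1)
    ⟨e.source, e.open_source, by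
      rw [domain_eq]
      ext b
      constructor
      · rintro ⟨c, hc, rfl⟩
        have hm := e.map_target hc
        have h1 := hel _ hm
        rw [e.right_inv hc, hιl] at h1
        exact ⟨⟨ball_subset_closedBall (heU hm), by simp only [Function.comp_apply]; linarith⟩, hm⟩
      · rintro ⟨hb, hbs⟩
        obtain ⟨c, hc⟩ := hιs (e b) (by rw [hel b hbs, hb.2, heq, sub_self])
        exact ⟨c, by rw [mem_preimage, hc]; exact e.map_source hbs, by
          simp only [Function.comp_apply, hc, e.left_inv hbs]⟩⟩
  have h00 : (e.symm ∘ ι) 0 = a := by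
    rw [Function.comp_apply, ContinuousLinearMap.map_zero, ← he0, e.left_inv hae]
  rw [h00] at hres
  exact ⟨_, _, hres⟩

end IsIsotropicParametrization

end Submanifolds

/-! ### Holomorphic functions as smooth real maps -/

section Holomorphic

variable {E : Type*} [NormedAddCommGroup E] [NormedSpace ℂ E]
  {N : Type*} [TopologicalSpace N] [ChartedSpace E N] {f : N → ℂ}

/-- The derivative of a complex function, as a linear form on the model space. -/
def complexDeriv (f : N → ℂ) (y : N) : E →L[ℂ] ℂ := mfderiv 𝓘(ℂ, E) 𝓘(ℂ, ℂ) f y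

theorem hasMFDerivAt_real {y : N} (hf : MDifferentiableAt 𝓘(ℂ, E) 𝓘(ℂ, ℂ) f y) :
    HasMFDerivAt 𝓘(ℝ, E) 𝓘(ℝ, ℂ) f y
      ((complexDeriv f y).restrictScalars ℝ : E →L[ℝ] ℂ) := by
  have h := hf.hasMFDerivAt
  refine ⟨h.1, ?_⟩
  have h2 : HasFDerivWithinAt _ (complexDeriv f y) _ _ := h.2
  exact h2.restrictScalars ℝ

theorem contMDiff_real (hf : ContMDiff 𝓘(ℂ, E) 𝓘(ℂ, ℂ) ω f) :
    ContMDiff 𝓘(ℝ, E) 𝓘(ℝ, ℂ) ∞ f := by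
  intro y
  obtain ⟨h1, h2⟩ := contMDiffAt_iff.1 (hf y)
  exact contMDiffAt_iff.2 ⟨h1, (h2.restrict_scalars ℝ).of_le le_top⟩

end Holomorphic

/-! ### The induced metric and its horizontal gradient -/

section Parametrization

variable {E : Type*} [NormedAddCommGroup E] [NormedSpace ℂ E]
  {N : Type*} [TopologicalSpace N] [ChartedSpace E N] [IsManifold 𝓘(ℂ, E) ω N]
  {h : HermitianMetric E N} {n : ℕ} {V : Set N} {x : N}
  {W : Set (EuclideanSpace ℝ (Fin n))} {φ : EuclideanSpace ℝ (Fin n) → N}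

/-- The derivative of a parametrization, as a linear map into the model space. -/
def velocity (E : Type*) [NormedAddCommGroup E] [NormedSpace ℂ E]
    {N : Type*} [TopologicalSpace N] [ChartedSpace E N] {n : ℕ}
    (φ : EuclideanSpace ℝ (Fin n) → N) (a : EuclideanSpace ℝ (Fin n)) :
    EuclideanSpace ℝ (Fin n) →L[ℝ] E :=
  mfderiv 𝓘(ℝ, EuclideanSpace ℝ (Fin n)) 𝓘(ℝ, E) φ a

/-- The metric on a tangent space, as a bilinear form on the model space. -/
def HermitianMetric.bilin (h : HermitianMetric E N) (y : N) : E →L[ℝ] E →L[ℝ] ℝ := h.inner y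

/-- The pull-back of the metric by a parametrization. -/
def HermitianMetric.pullback (h : HermitianMetric E N) (φ : EuclideanSpace ℝ (Fin n) → N)
    (a : EuclideanSpace ℝ (Fin n)) :
    EuclideanSpace ℝ (Fin n) →L[ℝ] EuclideanSpace ℝ (Fin n) →L[ℝ] ℝ :=
  (h.bilin (φ a)).bilinearComp (velocity E φ a) (velocity E φ a)

theorem HermitianMetric.bilin_I (h : HermitianMetric E N) (y : N) (u v : E) :
    h.bilin y (Complex.I • u) (Complex.I • v) = h.bilin y u v :=
  h.inner_J y u v

theorem HermitianMetric.bilin_pos (h : HermitianMetric E N) (y : N) {u : E} (hu : u ≠ 0) :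
    0 < h.bilin y u u :=
  h.pos y u hu

namespace IsIsotropicParametrization

variable (hφ : IsIsotropicParametrization h n V x 0 W φ)

include hφ

theorem velocity_injective {a} (ha : a ∈ W) : Function.Injective (velocity E φ a) :=
  hφ.immersion a ha le_rfl

theorem bilin_I_velocity {a} (ha : a ∈ W) (u v : EuclideanSpace ℝ (Fin n)) :
    h.bilin (φ a) (Complex.I • velocity E φ a u) (velocity E φ a v) = 0 :=
  hφ.isotropic a ha le_rfl u v

/-- The tangent map of `φ` turns constant fields into smooth sections along `φ`, on which the smooth
metric is evaluated. Class `C¹` is what the gradient flow needs. -/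
theorem contDiffOn_pullback : ContDiffOn ℝ 1 (h.pullback φ) W := by
  rw [contDiffOn_clm_apply]
  intro u
  rw [contDiffOn_clm_apply]
  intro v
  have hT := hφ.smooth.contMDiffOn_tangentMapWithin (m := 1) (by exact WithTop.coe_le_coe.2 le_top)
    hφ.isOpen.uniqueMDiffOn
  have hsec : ∀ u : EuclideanSpace ℝ (Fin n),
      ContMDiffOn 𝓘(ℝ, EuclideanSpace ℝ (Fin n)) 𝓘(ℝ, E).tangent 1
        (fun a => (⟨φ a, velocity E φ a u⟩ : TangentBundle 𝓘(ℝ, E) N)) W := fun u => by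
    have hc : ContMDiffOn 𝓘(ℝ, EuclideanSpace ℝ (Fin n))
        𝓘(ℝ, EuclideanSpace ℝ (Fin n)).tangent 1
        (fun a => (⟨a, u⟩ : TangentBundle 𝓘(ℝ, EuclideanSpace ℝ (Fin n))
          (EuclideanSpace ℝ (Fin n)))) W :=
      contMDiffOn_vectorSpace_iff_contDiffOn.2 contDiffOn_const
    refine (hT.comp hc fun a ha => ha).congr fun a ha => ?_
    simp only [tangentMapWithin, Function.comp_apply, mfderivWithin_of_isOpen hφ.isOpen ha]
    rfl
  have hmain : ∀ a ∈ W, ContMDiffWithinAt 𝓘(ℝ, EuclideanSpace ℝ (Fin n)) (𝓘(ℝ, E).prod 𝓘(ℝ)) 1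
      (fun a => Bundle.TotalSpace.mk' ℝ (E := Bundle.Trivial N ℝ) (φ a)
        (h.pullback φ a u v)) W a := fun a ha => by
    apply ContMDiffWithinAt.clm_bundle_apply₂ (F₁ := E) (F₂ := E)
    · exact ContMDiffAt.comp_contMDiffWithinAt a
        (h.contMDiff.contMDiffAt.of_le (by exact WithTop.coe_le_coe.2 le_top))
        ((hφ.smooth a ha).of_le (by exact WithTop.coe_le_coe.2 le_top))
    · exact hsec u a ha
    · exact hsec v a ha
  intro a ha
  have h1 := hmain a ha
  simp only [Bundle.contMDiffWithinAt_totalSpace] at h1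
  exact h1.2.contDiffWithinAt

theorem pullback_pos {a} (ha : a ∈ W) {u : EuclideanSpace ℝ (Fin n)} (hu : u ≠ 0) :
    0 < h.pullback φ a u u := by
  have hne : velocity E φ a u ≠ 0 := fun h0 =>
    hu (hφ.velocity_injective ha (h0.trans (velocity E φ a).map_zero.symm))
  exact h.bilin_pos _ hne

theorem pullback_isInvertible {a} (ha : a ∈ W) : (h.pullback φ a).IsInvertible := by
  have hinj : Function.Injective (h.pullback φ a).toLinearMap := by
    rw [← LinearMap.ker_eq_bot, LinearMap.ker_eq_bot']
    intro u hu
    by_contra hne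
    have h1 := hφ.pullback_pos ha hne
    have h2 : h.pullback φ a u = 0 := hu
    simp [h2] at h1
  have hr : Module.finrank ℝ (EuclideanSpace ℝ (Fin n)) =
      Module.finrank ℝ (EuclideanSpace ℝ (Fin n) →L[ℝ] ℝ) := by
    rw [← (LinearMap.toContinuousLinearMap (𝕜 := ℝ) (E := EuclideanSpace ℝ (Fin n))
      (F' := ℝ)).finrank_eq, Subspace.dual_finrank_eq (K := ℝ) (V := EuclideanSpace ℝ (Fin n))]
  refine ⟨(LinearEquiv.ofInjectiveOfFinrankEq _ hinj hr).toContinuousLinearEquiv, ?_⟩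
  ext u v
  rfl

/-- The gradient of a function with respect to the induced metric. -/
theorem exists_gradient {q : EuclideanSpace ℝ (Fin n) → ℝ}
    (hq : ContDiffOn ℝ ∞ q W) :
    ∃ Y : EuclideanSpace ℝ (Fin n) → EuclideanSpace ℝ (Fin n), ContDiffOn ℝ 1 Y W ∧
      ∀ a ∈ W, ∀ u, h.pullback φ a (Y a) u = fderiv ℝ q a u := by
  refine ⟨fun a => (h.pullback φ a).inverse (fderiv ℝ q a), fun a ha => ?_, fun a ha u => ?_⟩
  · have hd : ContDiffAt ℝ 1 (fderiv ℝ q) a :=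
      (hq.contDiffAt (hφ.isOpen.mem_nhds ha)).fderiv_right (by exact WithTop.coe_le_coe.2 le_top)
    have hi : ContDiffAt ℝ 1 (fun a => (h.pullback φ a).inverse) a :=
      (hφ.pullback_isInvertible ha).contDiffAt_map_inverse.comp a
        (hφ.contDiffOn_pullback.contDiffAt (hφ.isOpen.mem_nhds ha))
    exact (hi.clm_apply hd).contDiffWithinAt
  · rw [(hφ.pullback_isInvertible ha).self_apply_inverse]

/-- A Lagrangian subspace and its image under the complex structure span the tangent space. -/
theorem exists_velocity_add_I [FiniteDimensional ℂ E] (hn : n = Module.finrank ℂ E) {a}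
    (ha : a ∈ W) (w : E) :
    ∃ u v, w = velocity E φ a u + Complex.I • velocity E φ a v := by
  let J : E →ₗ[ℝ] E := (LinearMap.lsmul ℂ E Complex.I).restrictScalars ℝ
  let L : EuclideanSpace ℝ (Fin n) × EuclideanSpace ℝ (Fin n) →ₗ[ℝ] E :=
    (velocity E φ a).toLinearMap.coprod (J ∘ₗ (velocity E φ a).toLinearMap)
  have hL : ∀ p, L p = velocity E φ a p.1 + Complex.I • velocity E φ a p.2 := fun p => rfl
  have : FiniteDimensional ℝ E := FiniteDimensional.complexToReal E
  have hinj : Function.Injective L := by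
    rw [← LinearMap.ker_eq_bot, LinearMap.ker_eq_bot']
    rintro ⟨u, v⟩ huv
    rw [hL] at huv
    have hu : velocity E φ a u = -(Complex.I • velocity E φ a v) := eq_neg_of_add_eq_zero_left huv
    -- If `dφ u = -J dφ v`, isotropy gives `0 = h(J dφ v, dφ u) = -h(dφ v, dφ v)`.
    have hv : v = 0 := by
      by_contra hv
      have h1 := hφ.pullback_pos ha hv
      have h2 := hφ.bilin_I_velocity ha v u
      rw [hu, map_neg, h.bilin_I] at h2
      have h3 : h.pullback φ a v v = h.bilin (φ a) (velocity E φ a v) (velocity E φ a v) := rfl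
      rw [h3] at h1
      linarith
    subst hv
    rw [ContinuousLinearMap.map_zero, smul_zero, neg_zero] at hu
    rw [hφ.velocity_injective ha (hu.trans (velocity E φ a).map_zero.symm)]
    rfl
  have hr : Module.finrank ℝ (EuclideanSpace ℝ (Fin n) × EuclideanSpace ℝ (Fin n)) =
      Module.finrank ℝ E := by
    rw [Module.finrank_prod, finrank_euclideanSpace_fin, finrank_real_of_complex, ← hn]
    ring
  obtain ⟨p, hp⟩ := (LinearMap.injective_iff_surjective_of_finrank_eq_finrank hr).1 hinj w
  exact ⟨p.1, p.2, by rw [← hp, hL]⟩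

/-- The gradient of the real part of a holomorphic function, along a Lagrangian submanifold on
which the imaginary part is constant, is horizontal. -/
theorem form_gradient_eq_zero [FiniteDimensional ℂ E] (hn : n = Module.finrank ℂ E) {a}
    (ha : a ∈ W) {df : E →L[ℂ] ℂ} (him : ∀ u, (df (velocity E φ a u)).im = 0)
    {y : EuclideanSpace ℝ (Fin n)} {s : ℝ}
    (hy : ∀ u, h.pullback φ a y u = s * (df (velocity E φ a u)).re) {w : E} (hw : df w = 0) :
    h.bilin (φ a) (Complex.I • velocity E φ a y) w = 0 := by
  obtain ⟨u, v, rfl⟩ := hφ.exists_velocity_add_I hn ha w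
  -- In the imaginary part of `df w = 0` the `u` term drops out, and the factor `i` turns the `v`
  -- term into a real part.
  have h1 : (df (velocity E φ a v)).re = 0 := by
    have := congrArg Complex.im hw
    simpa [him] using this
  have h2 := hy v
  rw [h1, mul_zero] at h2
  rw [map_add, hφ.bilin_I_velocity ha, h.bilin_I, zero_add]
  exact h2

end IsIsotropicParametrization

end Parametrization

/-! ### Second derivatives at a critical point -/

section SecondDerivative

/-- In the second-order chain rule the term with the second derivative of `ψ` is multiplied by `dR`,
which vanishes. -/
theorem fderiv_fderiv_comp_of_critical {F G : Type*} [NormedAddCommGroup F] [NormedSpace ℝ F]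
    [NormedAddCommGroup G] [NormedSpace ℝ G] {R : G → ℝ} {ψ : F → G} {a : F}
    (hR : ContDiffAt ℝ 2 R (ψ a)) (hψ : ContDiffAt ℝ 2 ψ a) (h0 : fderiv ℝ R (ψ a) = 0) (u : F) :
    fderiv ℝ (fderiv ℝ (R ∘ ψ)) a u u =
      fderiv ℝ (fderiv ℝ R) (ψ a) (fderiv ℝ ψ a u) (fderiv ℝ ψ a u) := by
  have hev : fderiv ℝ (R ∘ ψ) =ᶠ[𝓝 a] fun b => (fderiv ℝ R (ψ b)).comp (fderiv ℝ ψ b) := by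
    filter_upwards [hψ.eventually (by simp), hψ.continuousAt.eventually (hR.eventually (by simp))]
      with b hb hb'
    exact fderiv_comp b (hb'.differentiableAt (by simp)) (hb.differentiableAt (by simp))
  have h1 : HasFDerivAt (fderiv ℝ R) (fderiv ℝ (fderiv ℝ R) (ψ a)) (ψ a) :=
    ((hR.fderiv_right (m := 1) (by norm_num)).differentiableAt one_ne_zero).hasFDerivAt
  have h2 : HasFDerivAt ψ (fderiv ℝ ψ a) a := (hψ.differentiableAt (by simp)).hasFDerivAt
  have h3 : HasFDerivAt (fderiv ℝ ψ) (fderiv ℝ (fderiv ℝ ψ) a) a :=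
    ((hψ.fderiv_right (m := 1) (by norm_num)).differentiableAt one_ne_zero).hasFDerivAt
  have h4 : HasFDerivAt (fun b => (fderiv ℝ R (ψ b)).comp (fderiv ℝ ψ b)) _ a :=
    (h1.comp a h2).clm_comp h3
  rw [hev.fderiv_eq, h4.fderiv]
  simp [h0]

theorem fderiv_re {E : Type*} [NormedAddCommGroup E] [NormedSpace ℂ E] {F : E → ℂ} {z : E}
    (hF : DifferentiableAt ℂ F z) (s c : ℝ) (v : E) :
    fderiv ℝ (fun z => s * (c - (F z).re)) z v = -s * (fderiv ℂ F z v).re := by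
  have h1 := Complex.reCLM.hasFDerivAt.comp z (hF.hasFDerivAt.restrictScalars ℝ)
  have h2 : HasFDerivAt (fun z => s * (c - (F z).re)) _ z := (h1.const_sub c).const_mul s
  rw [h2.fderiv]
  simp

theorem fderiv_fderiv_re {E : Type*} [NormedAddCommGroup E] [NormedSpace ℂ E] {F : E → ℂ} {z : E}
    (hF : ContDiffAt ℂ 2 F z) (s c : ℝ) (v w : E) :
    fderiv ℝ (fderiv ℝ fun z => s * (c - (F z).re)) z v w =
      -s * (fderiv ℂ (fderiv ℂ F) z v w).re := by
  set R : E → ℝ := fun z => s * (c - (F z).re) with hR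
  have hRs : ContDiffAt ℝ 2 R z :=
    contDiffAt_const.mul (contDiffAt_const.sub
      (Complex.reCLM.contDiff.contDiffAt.comp z (hF.restrict_scalars ℝ)))
  have h1 : HasFDerivAt (fderiv ℝ R) (fderiv ℝ (fderiv ℝ R) z) z :=
    ((hRs.fderiv_right (m := 1) (by norm_num)).differentiableAt one_ne_zero).hasFDerivAt
  have h2 : HasFDerivAt (fderiv ℂ F) (fderiv ℂ (fderiv ℂ F) z) z :=
    ((hF.fderiv_right (m := 1) (by norm_num)).differentiableAt one_ne_zero).hasFDerivAt
  have h3 := h1.clm_apply (hasFDerivAt_const w z)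
  have h4 := (h2.clm_apply (hasFDerivAt_const w z)).restrictScalars ℝ
  have h5 := (Complex.reCLM.hasFDerivAt.comp z h4).const_mul (-s)
  have hev : (fun y => fderiv ℝ R y w) =ᶠ[𝓝 z] fun y => -s * (fderiv ℂ F y w).re := by
    filter_upwards [hF.eventually (by simp)] with y hy
    exact fderiv_re (hy.differentiableAt (by simp)) s c w
  have h6 := congrArg (fun L => L v) (h3.unique (h5.congr_of_eventuallyEq hev))
  simpa using h6

end SecondDerivative

/-! ### The well cut out by `f` on the Lagrangian -/

section Well

variable {E : Type*} [NormedAddCommGroup E] [NormedSpace ℂ E]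
  {N : Type*} [TopologicalSpace N] [ChartedSpace E N] [IsManifold 𝓘(ℂ, E) ω N]
  {h : HermitianMetric E N} {n : ℕ} {V : Set N} {x : N}
  {W : Set (EuclideanSpace ℝ (Fin n))} {φ : EuclideanSpace ℝ (Fin n) → N} {f : N → ℂ}

namespace IsIsotropicParametrization

variable (hφ : IsIsotropicParametrization h n V x 0 W φ)

include hφ

theorem mem_submanifold {a} (ha : a ∈ W) : φ a ∈ V := by
  obtain ⟨O, -, hO⟩ := hφ.image
  rw [domain_eq] at hO
  exact (hO.le ⟨a, ha, rfl⟩).1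

/-- The images of straight lines through `0` are curves in `V`; this brings definiteness on `T_x V`
to bear on the parametrization. -/
theorem velocity_mem_tangentVectors (u : EuclideanSpace ℝ (Fin n)) :
    velocity E φ 0 u ∈ tangentVectors E V x := by
  have hl : HasFDerivAt (fun t : ℝ => t • u) ((1 : ℝ →L[ℝ] ℝ).smulRight u) 0 :=
    (1 : ℝ →L[ℝ] ℝ).smulRight u |>.hasFDerivAt
  have h0 : (0 : ℝ) • u = 0 := zero_smul ℝ u
  have hW : W ∈ 𝓝 ((0 : ℝ) • u) := h0 ▸ hφ.isOpen.mem_nhds hφ.zero_mem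
  have hd := (hφ.mdifferentiableAt (h0 ▸ hφ.zero_mem : (0 : ℝ) • u ∈ W)).hasMFDerivAt.comp (0 : ℝ)
    hl.hasMFDerivAt
  refine ⟨φ ∘ fun t : ℝ => t • u, ?_, ?_, ?_, ?_⟩
  · simp [hφ.map_zero]
  · have hs : ContMDiffAt 𝓘(ℝ, EuclideanSpace ℝ (Fin n)) 𝓘(ℝ, E) ∞ φ ((0 : ℝ) • u) :=
      (hφ.smooth _ (mem_of_mem_nhds hW)).contMDiffAt hW
    exact hs.comp (0 : ℝ) (by fun_prop : ContDiffAt ℝ ∞ (fun t : ℝ => t • u) 0).contMDiffAt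
  · have hc : ContinuousAt (fun t : ℝ => t • u) 0 := by fun_prop
    filter_upwards [hc.eventually hW] with t ht using hφ.mem_submanifold ht
  · rw [hd.mfderiv]
    have h1 : mfderiv 𝓘(ℝ, EuclideanSpace ℝ (Fin n)) 𝓘(ℝ, E) φ ((0 : ℝ) • u) ((1 : ℝ) • u) =
        velocity E φ 0 u := by
      rw [one_smul, h0]; rfl
    exact h1

theorem contDiffOn_comp (hf : ContMDiff 𝓘(ℂ, E) 𝓘(ℂ, ℂ) ω f) : ContDiffOn ℝ ∞ (f ∘ φ) W :=
  ((contMDiff_real hf).comp_contMDiffOn hφ.smooth).contDiffOn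

theorem hasFDerivAt_comp (hf : ContMDiff 𝓘(ℂ, E) 𝓘(ℂ, ℂ) ω f) {a} (ha : a ∈ W) :
    HasFDerivAt (f ∘ φ) (((complexDeriv f (φ a)).restrictScalars ℝ : E →L[ℝ] ℂ).comp
      (velocity E φ a)) a := by
  have h1 := (hasMFDerivAt_real (hf.mdifferentiable (by simp) (φ a))).comp a
    (hφ.mdifferentiableAt ha).hasMFDerivAt
  exact h1.hasFDerivAt

theorem fderiv_well (hf : ContMDiff 𝓘(ℂ, E) 𝓘(ℂ, ℂ) ω f) {a} (ha : a ∈ W) (s c : ℝ)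
    (u : EuclideanSpace ℝ (Fin n)) :
    fderiv ℝ (fun a => s * (c - (f (φ a)).re)) a u =
      -s * (complexDeriv f (φ a) (velocity E φ a u)).re := by
  have h1 := Complex.reCLM.hasFDerivAt.comp a (hφ.hasFDerivAt_comp hf ha)
  have h2 : HasFDerivAt (fun a => s * (c - (f (φ a)).re)) _ a := (h1.const_sub c).const_mul s
  rw [h2.fderiv]
  simp

theorem im_complexDeriv_velocity (hf : ContMDiff 𝓘(ℂ, E) 𝓘(ℂ, ℂ) ω f) {c : ℝ}
    (hc : ∀ y ∈ V, (f y).im = c) {a} (ha : a ∈ W) (u : EuclideanSpace ℝ (Fin n)) :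
    (complexDeriv f (φ a) (velocity E φ a u)).im = 0 := by
  have h1 := Complex.imCLM.hasFDerivAt.comp a (hφ.hasFDerivAt_comp hf ha)
  have h2 : HasFDerivAt (Complex.imCLM ∘ (f ∘ φ)) (0 : EuclideanSpace ℝ (Fin n) →L[ℝ] ℝ) a := by
    refine (hasFDerivAt_const c a).congr_of_eventuallyEq ?_
    filter_upwards [hφ.isOpen.mem_nhds ha] with b hb using hc _ (hφ.mem_submanifold hb)
  exact congrArg (fun L : EuclideanSpace ℝ (Fin n) →L[ℝ] ℝ => L u) (h1.unique h2)

theorem contDiffOn_well (hf : ContMDiff 𝓘(ℂ, E) 𝓘(ℂ, ℂ) ω f) (s c : ℝ) :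
    ContDiffOn ℝ ∞ (fun a => s * (c - (f (φ a)).re)) W :=
  contDiffOn_const.mul (contDiffOn_const.sub
    (Complex.reCLM.contDiff.comp_contDiffOn (hφ.contDiffOn_comp hf)))

/-- Both `f` and `φ` are read in the preferred chart at `x`, where `hessian` is defined; criticality
removes the curvature of `φ`. -/
theorem fderiv_fderiv_well (hf : ContMDiff 𝓘(ℂ, E) 𝓘(ℂ, ℂ) ω f)
    (hx : IsCriticalPoint (E := E) f x) (s c : ℝ) (u : EuclideanSpace ℝ (Fin n)) :
    fderiv ℝ (fderiv ℝ fun a => s * (c - (f (φ a)).re)) 0 u u =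
      -s * (hessian f x (velocity E φ 0 u) (velocity E φ 0 u)).re := by
  obtain rfl := hφ.map_zero
  have hsm : ContMDiffAt 𝓘(ℝ, EuclideanSpace ℝ (Fin n)) 𝓘(ℝ, E) ∞ φ 0 :=
    (hφ.smooth 0 hφ.zero_mem).contMDiffAt (hφ.isOpen.mem_nhds hφ.zero_mem)
  set ψ : EuclideanSpace ℝ (Fin n) → E := chartAt E (φ 0) ∘ φ with hψ
  set F : E → ℂ := f ∘ (chartAt E (φ 0)).symm with hF
  have hψs : ContDiffAt ℝ ∞ ψ 0 := by
    have h1 := (contMDiffAt_iff.1 hsm).2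
    simpa [hψ, mfld_simps, contDiffWithinAt_univ, chartAt_self_eq] using h1
  have hvel : velocity E φ 0 = fderiv ℝ ψ 0 := by
    rw [velocity, (hφ.mdifferentiableAt hφ.zero_mem).mfderiv]
    simp only [writtenInExtChartAt, mfld_simps, fderivWithin_univ]
    rfl
  have hFs : ContDiffAt ℂ ω F (ψ 0) := by
    have h1 := (contMDiffAt_iff.1 (hf (φ 0))).2
    simpa [hF, hψ, mfld_simps, contDiffWithinAt_univ, chartAt_self_eq] using h1
  have hF0 : fderiv ℂ F (ψ 0) = 0 := by
    have h1 : mfderiv 𝓘(ℂ, E) 𝓘(ℂ, ℂ) f (φ 0) = 0 := hx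
    rw [(hf.mdifferentiable (by simp) (φ 0)).mfderiv] at h1
    simp only [writtenInExtChartAt, mfld_simps, fderivWithin_univ] at h1
    exact h1
  have hev : (fun a => s * (c - (f (φ a)).re)) =ᶠ[𝓝 0] (fun z => s * (c - (F z).re)) ∘ ψ := by
    filter_upwards [hsm.continuousAt.eventually
      ((chartAt E (φ 0)).open_source.mem_nhds (mem_chart_source E (φ 0)))] with a ha
    simp only [hF, hψ, Function.comp_apply, (chartAt E (φ 0)).left_inv ha]
  have hR : ContDiffAt ℝ 2 (fun z => s * (c - (F z).re)) (ψ 0) :=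
    contDiffAt_const.mul (contDiffAt_const.sub
      (Complex.reCLM.contDiff.contDiffAt.comp _ ((hFs.restrict_scalars ℝ).of_le le_top)))
  have hR0 : fderiv ℝ (fun z => s * (c - (F z).re)) (ψ 0) = 0 := by
    ext v
    rw [fderiv_re (hFs.differentiableAt (by simp)), hF0]
    simp
  rw [hev.fderiv.fderiv_eq, fderiv_fderiv_comp_of_critical hR
    (hψs.of_le (by exact WithTop.coe_le_coe.2 le_top)) hR0,
    fderiv_fderiv_re (hFs.of_le le_top), hvel]
  rfl

/-- Along a Lagrangian submanifold on which the Hessian is definite, the real part of `f` has a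
nondegenerate extremum at the critical point. -/
theorem exists_isConvexWell (hf : ContMDiff 𝓘(ℂ, E) 𝓘(ℂ, ℂ) ω f)
    (hx : IsCriticalPoint (E := E) f x) {s : ℝ}
    (hdef : ∀ v ∈ tangentVectors E V x, v ≠ 0 → s * (hessian f x v v).re < 0) :
    ∃ r, closedBall 0 r ⊆ W ∧ IsConvexWell (fun a => s * ((f x).re - (f (φ a)).re)) r := by
  refine LefschetzThimble.exists_isConvexWell (hφ.isOpen.mem_nhds hφ.zero_mem) ?_
    (by simp [hφ.map_zero]) ?_ fun u hu => ?_
  · filter_upwards [hφ.isOpen.mem_nhds hφ.zero_mem] with a ha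
    exact (hφ.contDiffOn_well hf s _).contDiffAt (hφ.isOpen.mem_nhds ha)
  · ext u
    rw [hφ.fderiv_well hf hφ.zero_mem]
    have : complexDeriv (E := E) f (φ 0) = 0 := by
      rw [hφ.map_zero]; exact hx
    simp [this]
  · rw [hφ.fderiv_fderiv_well hf hx]
    have hne : velocity E φ 0 u ≠ 0 := fun h0 =>
      hu (hφ.velocity_injective hφ.zero_mem (h0.trans (velocity E φ 0).map_zero.symm))
    linarith [hdef _ (hφ.velocity_mem_tangentVectors u) hne]

end IsIsotropicParametrization

end Well

/-! ### Regularity of the path -/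

section RegularValues

variable {E : Type*} [NormedAddCommGroup E] [NormedSpace ℂ E]
  {N : Type*} [TopologicalSpace N] [ChartedSpace E N]

/-- Near an isolated critical value, the points of a short segment ending at it are regular. -/
theorem exists_isRegularValue {f : N → ℂ} (hf : IsLefschetzFibration E f) (x : N) {s : ℝ}
    (hs : s * s = 1) :
    ∃ ρ₀ > 0, ∀ ρ, 0 < ρ → ρ < ρ₀ → ∀ t ∈ Ico (0 : ℝ) 1,
      IsRegularValue (E := E) f ⟨(f x).re - s * ((1 - t) * ρ), (f x).im⟩ := by
  have hfin : (f '' {y | IsCriticalPoint (E := E) f y} \ {f x}).Finite :=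
    (hf.finite_critical.image f).subset sdiff_subset
  -- A ball about `f x` misses the other critical values, a finite set; `f x` itself is avoided
  -- because `(1 - t) ρ > 0`.
  obtain ⟨ρ₀, hρ₀, hball⟩ := Metric.isOpen_iff.1 hfin.isClosed.isOpen_compl (f x) (fun hx => hx.2 rfl)
  refine ⟨ρ₀, hρ₀, fun ρ hρ hρρ₀ t ht y hy hcrit => ?_⟩
  have hpos : 0 < (1 - t) * ρ := mul_pos (sub_pos.2 ht.2) hρ
  have hs1 : |s| = 1 := by
    have : |s| * |s| = 1 := by rw [← abs_mul, hs, abs_one]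
    nlinarith [abs_nonneg s]
  have hsub : f y - f x = ((-(s * ((1 - t) * ρ)) : ℝ) : ℂ) := by
    rw [hy]
    apply Complex.ext <;> simp
  refine hball (a := f y) ?_ ⟨⟨y, hcrit, rfl⟩, fun he => ?_⟩
  · rw [mem_ball, dist_eq_norm, hsub, Complex.norm_real, norm_neg, norm_mul, Real.norm_eq_abs, hs1,
      one_mul, Real.norm_of_nonneg hpos.le]
    nlinarith [ht.1]
  · rw [mem_singleton_iff.1 he, sub_self] at hsub
    have h0 : -(s * ((1 - t) * ρ)) = 0 := by exact_mod_cast hsub.symm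
    have hs0 : s ≠ 0 := by rintro rfl; simp at hs1
    exact (mul_ne_zero hs0 hpos.ne') (neg_eq_zero.1 h0)

end RegularValues

/-! ### The component of `x` and the thimble -/

section Thimble

variable {E : Type*} [NormedAddCommGroup E] [NormedSpace ℂ E]
  {N : Type*} [TopologicalSpace N] [ChartedSpace E N] [IsManifold 𝓘(ℂ, E) ω N]
  {h : HermitianMetric E N} {n : ℕ} {V : Set N} {x : N}
  {W : Set (EuclideanSpace ℝ (Fin n))} {φ : EuclideanSpace ℝ (Fin n) → N}
  {q : EuclideanSpace ℝ (Fin n) → ℝ} {r ρ : ℝ}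

namespace IsIsotropicParametrization

variable (hφ : IsIsotropicParametrization h n V x 0 W φ)

include hφ

theorem continuousOn : ContinuousOn φ W := hφ.smooth.continuousOn

theorem preimage_mem_nhds {U : Set N} (hU : U ∈ 𝓝 x) : φ ⁻¹' U ∈ 𝓝 0 :=
  (hφ.continuousOn.continuousAt (hφ.isOpen.mem_nhds hφ.zero_mem)) (by rwa [hφ.map_zero])

theorem exists_image_ball_eq (hr : 0 < r) (hW : closedBall 0 r ⊆ W) :
    ∃ O : Set N, IsOpen O ∧ x ∈ O ∧ φ '' ball 0 r = V ∩ O := by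
  obtain ⟨O, hO, hVO⟩ := hφ.image
  rw [domain_eq] at hVO
  obtain ⟨Q, hQ, hQ'⟩ := hφ.exists_image_inter_eq (O := ball 0 r) isOpen_ball
  have h1 := hQ' W subset_rfl
  rw [inter_eq_right.2 (ball_subset_closedBall.trans hW), hVO, inter_assoc] at h1
  refine ⟨O ∩ Q, hO.inter hQ, ?_, h1⟩
  exact (h1.le ⟨0, mem_ball_self hr, hφ.map_zero⟩).2

theorem image_sublevel_eq_inter (hq : IsConvexWell q r) (hW : closedBall 0 r ⊆ W)
    (hsub : sublevel q r ρ ⊆ ball 0 r) {Q : N → ℝ} (hQ : ∀ a, Q (φ a) = q a) {O : Set N}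
    (hO : φ '' ball 0 r = V ∩ O) :
    φ '' sublevel q r ρ = Q ⁻¹' Icc 0 ρ ∩ V ∩ O := by
  ext y
  constructor
  · rintro ⟨a, ha, rfl⟩
    refine ⟨⟨⟨?_, ?_⟩, hφ.mem_submanifold (hW ha.1)⟩, (hO.le ⟨a, hsub ha, rfl⟩).2⟩
    · rw [hQ]; exact hq.nonneg ha.1
    · rw [hQ]; exact ha.2
  · rintro ⟨⟨hy, hyV⟩, hyO⟩
    obtain ⟨a, ha, rfl⟩ := hO.ge ⟨hyV, hyO⟩
    exact ⟨a, ⟨ball_subset_closedBall ha, by rw [← hQ]; exact hy.2⟩, rfl⟩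

/-- The component of the minimum in a small sublevel set of the submanifold. -/
theorem connectedComponentIn_eq [T2Space N] (hq : IsConvexWell q r) (hW : closedBall 0 r ⊆ W)
    (hρ : 0 ≤ ρ) (hsub : sublevel q r ρ ⊆ ball 0 r) {Q : N → ℝ} (hQ : ∀ a, Q (φ a) = q a) :
    connectedComponentIn (Q ⁻¹' Icc 0 ρ ∩ V) x = φ '' sublevel q r ρ := by
  obtain ⟨O, hOo, hxO, hO⟩ := hφ.exists_image_ball_eq hq.radius_pos hW
  have hA := hφ.image_sublevel_eq_inter hq hW hsub hQ hO
  have hcont : ContinuousOn φ (sublevel q r ρ) := hφ.continuousOn.mono fun a ha => hW ha.1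
  have hxA : x ∈ φ '' sublevel q r ρ := ⟨0, hq.zero_mem_sublevel hρ, hφ.map_zero⟩
  have hsubK : φ '' sublevel q r ρ ⊆ Q ⁻¹' Icc 0 ρ ∩ V := hA.le.trans inter_subset_left
  apply Subset.antisymm
  · have hcl : IsClosed (φ '' sublevel q r ρ) :=
      (hq.isCompact_sublevel.image_of_continuousOn hcont).isClosed
    intro y hy
    by_contra hyA
    -- The image is closed, being compact, and is also the trace of the open set `O` on `K`. A
    -- connected part of `K` that left it would contain a point of `O` outside it.
    obtain ⟨z, hz, hzO, hzA⟩ := isPreconnected_connectedComponentIn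
      (F := Q ⁻¹' Icc 0 ρ ∩ V) (x := x) O (φ '' sublevel q r ρ)ᶜ hOo hcl.isOpen_compl
      (fun z hz => by
        by_cases hzA : z ∈ φ '' sublevel q r ρ
        · exact Or.inl (hA.le hzA).2
        · exact Or.inr hzA)
      ⟨x, mem_connectedComponentIn (hsubK hxA), hxO⟩ ⟨y, hy, hyA⟩
    exact hzA (hA.ge ⟨connectedComponentIn_subset _ _ hz, hzO⟩)
  · exact (hq.convex_sublevel.isPreconnected.image φ hcont).subset_connectedComponentIn hxA hsubK

theorem exists_homeomorph_image_sublevel (hq : IsConvexWell q r) (hW : closedBall 0 r ⊆ W)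
    (hρ : 0 < ρ) (hsub : sublevel q r ρ ⊆ ball 0 r) :
    ∃ Φ : (φ '' sublevel q r ρ : Set N) ≃ₜ closedBall (0 : EuclideanSpace ℝ (Fin n)) 1,
      ∀ p : (φ '' sublevel q r ρ : Set N), (p : N) ∈ φ '' {a ∈ closedBall 0 r | q a = ρ} ↔
        ‖(Φ p : EuclideanSpace ℝ (Fin n))‖ = 1 := by
  have hSW : sublevel q r ρ ⊆ W := fun a ha => hW ha.1
  obtain ⟨Φ, hΦ⟩ := hq.exists_homeomorph_closedBall hρ hsub
  have hemb := isEmbedding_domRestrict_mono hφ.isEmbedding hSW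
  let e : sublevel q r ρ ≃ₜ (φ '' sublevel q r ρ : Set N) :=
    hemb.toHomeomorph.trans (Homeomorph.setCongr (range_domRestrict φ _))
  have he : ∀ a, (e a : N) = φ a := fun a => rfl
  refine ⟨e.symm.trans Φ, fun p => ?_⟩
  obtain ⟨a, rfl⟩ := e.surjective p
  rw [he, Homeomorph.trans_apply, e.symm_apply_apply, ← hΦ]
  constructor
  · rintro ⟨b, hb, hba⟩
    rw [← hφ.injOn (hW hb.1) (hSW a.2) hba]
    exact hb.2
  · exact fun hqa => ⟨a, ⟨a.2.1, hqa⟩, rfl⟩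

end IsIsotropicParametrization

theorem lineMap_eq (z : ℂ) (s ρ t : ℝ) :
    AffineMap.lineMap (k := ℝ) (⟨z.re - s * ρ, z.im⟩ : ℂ) z t =
      ⟨z.re - s * ((1 - t) * ρ), z.im⟩ := by
  apply Complex.ext
  · simp [AffineMap.lineMap_apply]
    ring
  · simp [AffineMap.lineMap_apply]

variable [FiniteDimensional ℂ E] {f : N → ℂ} {s : ℝ}

/-- The gradient flow of the well, on the submanifold, is the parallel transport. -/
theorem IsIsotropicParametrization.exists_parallel_transport
    (hφ : IsIsotropicParametrization h n V x 0 W φ) (hn : n = Module.finrank ℂ E)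
    (hf : ContMDiff 𝓘(ℂ, E) 𝓘(ℂ, ℂ) ω f) (hconst : ∀ y ∈ V, (f y).im = (f x).im)
    (hs : s * s = 1) (hqdef : q = fun a => s * ((f x).re - (f (φ a)).re))
    (hq : IsConvexWell q r) (hW : closedBall 0 r ⊆ W) (hρ : 0 < ρ)
    (hsub : sublevel q r ρ ⊆ ball 0 (r / 2)) :
    ∃ τ : ℝ → N → N,
      (∀ y ∈ φ '' {a ∈ closedBall 0 r | q a = ρ}, τ 0 y = y ∧
        IsHorizontalLift h f
          (fun t => AffineMap.lineMap (k := ℝ) (⟨(f x).re - s * ρ, (f x).im⟩ : ℂ) (f x) t)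
          (fun t => τ t y)) ∧
      (∀ U ∈ 𝓝 x, ∀ᶠ t in 𝓝[<] (1 : ℝ), ∀ y ∈ φ '' {a ∈ closedBall 0 r | q a = ρ}, τ t y ∈ U) ∧
      φ '' sublevel q r ρ =
        insert x (⋃ t ∈ Ico (0 : ℝ) 1, τ t '' (φ '' {a ∈ closedBall 0 r | q a = ρ})) := by
  obtain ⟨Y, hYs, hY⟩ := hφ.exists_gradient (q := q) (hqdef ▸ hφ.contDiffOn_well hf s _)
  have hY0 : Y 0 = 0 := by
    by_contra hne
    have h1 := hφ.pullback_pos hφ.zero_mem hne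
    rw [hY 0 hφ.zero_mem, hq.fderiv_zero] at h1
    simp at h1
  have hYpos : ∀ a ∈ closedBall (0 : EuclideanSpace ℝ (Fin n)) r, a ≠ 0 →
      0 < fderiv ℝ q a (Y a) := fun a ha ha0 => by
    rw [← hY a (hW ha)]
    refine hφ.pullback_pos (hW ha) fun h0 => ?_
    have h1 := hq.fderiv_pos a ha ha0
    rw [← hY a (hW ha), h0] at h1
    simp at h1
  obtain ⟨T, hT, hTs⟩ := hq.exists_transport hρ hsub
    (fun a ha => hYs.contDiffAt (hφ.isOpen.mem_nhds (hW ha))) hY0 hYpos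
  have hinv : ∀ a ∈ closedBall (0 : EuclideanSpace ℝ (Fin n)) r, Function.invFunOn φ W (φ a) = a :=
    fun a ha => hφ.injOn.leftInvOn_invFunOn (hW ha)
  -- The flow in the parameter space, carried to `N` through an inverse of `φ`; only its values on
  -- the cycle matter.
  refine ⟨fun t y => φ (T t (Function.invFunOn φ W y)), ?_, ?_, ?_⟩
  · rintro _ ⟨a, ⟨ha, hqa⟩, rfl⟩
    obtain ⟨hT0, hT1⟩ := hT a ⟨ha, hqa.le⟩ hqa
    simp only [hinv a ha]
    refine ⟨by rw [hT0], fun t ht => ?_⟩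
    obtain ⟨hmem, hval, l, hl⟩ := hT1 t ht
    have hTW : T t a ∈ W := hW hmem.1
    have hd : HasMFDerivWithinAt 𝓘(ℝ, ℝ) 𝓘(ℝ, E) (φ ∘ fun t => T t a) (Ico 0 1) t
        ((velocity E φ (T t a)).comp ((1 : ℝ →L[ℝ] ℝ).smulRight (l • Y (T t a)))) :=
      (hφ.mdifferentiableAt hTW).hasMFDerivAt.comp_hasMFDerivWithinAt t
        hl.hasFDerivWithinAt.hasMFDerivWithinAt
    refine ⟨?_, hd.mdifferentiableWithinAt, fun w hw => ?_⟩
    · refine Eq.trans ?_ (lineMap_eq _ _ _ _).symm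
      apply Complex.ext
      · have h1 : s * ((f x).re - (f (φ (T t a))).re) = (1 - t) * ρ := by
          rw [← hval, hqdef]
        rw [← h1]
        linear_combination ((f x).re - (f (φ (T t a))).re) * hs
      · exact hconst _ (hφ.mem_submanifold hTW)
    · have hder := hd.mfderivWithin
        ((uniqueDiffOn_Ico (0 : ℝ) 1).uniqueMDiffOn t ht)
      -- The factor is `-s` because `dq = -s Re df`. Retiming the flow only rescales the gradient,
      -- so horizontality persists.
      have hform := hφ.form_gradient_eq_zero hn hTW (df := complexDeriv f (φ (T t a)))
        (fun u => hφ.im_complexDeriv_velocity hf hconst hTW u) (y := Y (T t a)) (s := -s)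
        (fun u => by rw [hY _ hTW, hqdef, hφ.fderiv_well hf hTW]) (w := w) hw
      have hval : ∀ v : E, v = velocity E φ (T t a) (l • Y (T t a)) →
          h.bilin (φ (T t a)) (Complex.I • v) w = 0 := by
        rintro _ rfl
        rw [(velocity E φ (T t a)).map_smul, smul_comm, (h.bilin (φ (T t a))).map_smul, smul_apply,
          hform, smul_zero]
      refine hval _ ?_
      refine (congrArg (fun L : ℝ →L[ℝ] E => L 1) hder).trans ?_
      exact congrArg (velocity E φ (T t a)) (one_smul ℝ _)
  · intro U hU
    obtain ⟨ρ₀, hρ₀, hsm⟩ := hq.exists_sublevel_subset (hφ.preimage_mem_nhds hU)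
    have hlim : ∀ᶠ t in 𝓝 (1 : ℝ), (1 - t) * ρ < ρ₀ :=
      (by fun_prop : Continuous fun t : ℝ => (1 - t) * ρ).continuousAt.eventually_lt
        continuousAt_const (by simpa using hρ₀)
    filter_upwards [nhdsWithin_le_nhds hlim, Ico_mem_nhdsLT (zero_lt_one (α := ℝ))] with t ht ht'
    rintro _ ⟨a, ⟨ha, hqa⟩, rfl⟩
    obtain ⟨hmem, hval, -⟩ := (hT a ⟨ha, hqa.le⟩ hqa).2 t ht'
    rw [hinv a ha]
    exact hsm _ ht ⟨hmem.1, hval.le⟩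
  · ext y
    simp only [mem_insert_iff, mem_iUnion₂]
    constructor
    · rintro ⟨p, hp, rfl⟩
      rcases eq_or_ne p 0 with rfl | hp0
      · exact Or.inl hφ.map_zero
      · obtain ⟨a, ha, hqa, t, ht, rfl⟩ := hTs p hp hp0
        exact Or.inr ⟨t, ht, φ a, ⟨a, ⟨ha.1, hqa⟩, rfl⟩, by simp only [hinv a ha.1]⟩
    · rintro (rfl | ⟨t, ht, _, ⟨a, ⟨ha, hqa⟩, rfl⟩, rfl⟩)
      · exact ⟨0, hq.zero_mem_sublevel hρ.le, hφ.map_zero⟩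
      · simp only [hinv a ha]
        exact ⟨_, ((hT a ⟨ha, hqa.le⟩ hqa).2 t ht).1, rfl⟩

/-- Both signs of the theorem at once: `s = 1` for the negative definite and `s = -1` for the
positive definite case. -/
theorem exists_thimble [T2Space N] (hf : IsLefschetzFibration E f)
    (hV : IsLagrangianSubmanifold h V) (hxV : x ∈ V) (hx : IsCriticalPoint (E := E) f x)
    (hconst : ∀ y ∈ V, (f y).im = (f x).im) (hs : s * s = 1)
    (hdef : ∀ v ∈ tangentVectors E V x, v ≠ 0 → s * (hessian f x v v).re < 0)
    {Q : N → ℝ} (hQ : Q = fun y => s * ((f x).re - (f y).re)) :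
    (∃ O ∈ 𝓝 x, ∀ U ⊆ O, U ∈ 𝓝 x → ∃ ρ₀ > 0, ∀ ρ, 0 < ρ → ρ < ρ₀ →
      Q ⁻¹' Icc 0 ρ ∩ V ∩ U = connectedComponentIn (Q ⁻¹' Icc 0 ρ ∩ V) x) ∧
    ∃ ρ₀ > 0, ∀ ρ, 0 < ρ → ρ < ρ₀ → ∀ D, D = connectedComponentIn (Q ⁻¹' Icc 0 ρ ∩ V) x →
      Nonempty (D ≃ₜ closedBall (0 : EuclideanSpace ℝ (Fin (Module.finrank ℂ E))) 1) ∧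
      IsLagrangianThimble h f
        (fun t => AffineMap.lineMap (k := ℝ) (⟨(f x).re - s * ρ, (f x).im⟩ : ℂ) (f x) t) x
        (D ∩ Q ⁻¹' {ρ}) D := by
  obtain ⟨W, φ, hφ⟩ := hV x hxV
  obtain ⟨r, hW, hq⟩ := hφ.exists_isConvexWell hf.holomorphic hx hdef
  set q := fun a => s * ((f x).re - (f (φ a)).re) with hqdef
  have hQq : ∀ a, Q (φ a) = q a := fun a => by rw [hQ]
  obtain ⟨O, hOo, hxO, hO⟩ := hφ.exists_image_ball_eq hq.radius_pos hW
  obtain ⟨ρ₁, hρ₁, hsub⟩ := hq.exists_sublevel_subset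
    (ball_mem_nhds (0 : EuclideanSpace ℝ (Fin (Module.finrank ℂ E))) (half_pos hq.radius_pos))
  have hhalf : ball (0 : EuclideanSpace ℝ (Fin (Module.finrank ℂ E))) (r / 2) ⊆ ball 0 r :=
    ball_subset_ball (by linarith [hq.radius_pos])
  constructor
  -- `U ⊆ O` keeps the rest of `K` out of `U`; the converse inclusion needs the sublevel image to
  -- fit inside `U`, so the bound on `ρ` depends on `U`.
  · refine ⟨O, hOo.mem_nhds hxO, fun U hUO hU => ?_⟩
    obtain ⟨ρ₂, hρ₂, hsub₂⟩ := hq.exists_sublevel_subset (hφ.preimage_mem_nhds hU)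
    refine ⟨min ρ₁ ρ₂, lt_min hρ₁ hρ₂, fun ρ hρ hρlt => ?_⟩
    have hsubρ := (hsub ρ (hρlt.trans_le (min_le_left _ _))).trans hhalf
    rw [hφ.connectedComponentIn_eq hq hW hρ.le hsubρ hQq]
    have hA := hφ.image_sublevel_eq_inter hq hW hsubρ hQq hO
    apply Subset.antisymm
    · rintro y ⟨hy, hyU⟩
      exact hA.ge ⟨hy, hUO hyU⟩
    · rintro _ ⟨a, ha, rfl⟩
      exact ⟨(hA.le ⟨a, ha, rfl⟩).1, hsub₂ ρ (hρlt.trans_le (min_le_right _ _)) ha⟩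
  · obtain ⟨ρ₂, hρ₂, hreg⟩ := exists_isRegularValue hf x hs
    refine ⟨min ρ₁ ρ₂, lt_min hρ₁ hρ₂, fun ρ hρ hρlt D hD => ?_⟩
    have hsubh := hsub ρ (hρlt.trans_le (min_le_left _ _))
    have hsubρ := hsubh.trans hhalf
    rw [hφ.connectedComponentIn_eq hq hW hρ.le hsubρ hQq] at hD
    have hα : D ∩ Q ⁻¹' {ρ} = φ '' {a ∈ closedBall 0 r | q a = ρ} := by
      rw [hD]
      ext y
      constructor
      · rintro ⟨⟨a, ha, rfl⟩, hy⟩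
        exact ⟨a, ⟨ha.1, (hQq a).symm.trans hy⟩, rfl⟩
      · rintro ⟨a, ⟨ha, hqa⟩, rfl⟩
        exact ⟨⟨a, ⟨ha, hqa.le⟩, rfl⟩, (hQq a).trans hqa⟩
    rw [hα]
    subst hD
    obtain ⟨Φ, hΦ⟩ := hφ.exists_homeomorph_image_sublevel hq hW hρ hsubρ
    refine ⟨⟨Φ⟩, hx, ?_, by simp, ?_, ?_, hφ.isotropic_level hq hW hρ hsubρ,
      hφ.exists_parallel_transport rfl hf.holomorphic hconst hs hqdef hq hW hρ hsubh, ⟨Φ, hΦ⟩,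
      hφ.isotropic_sublevel hq hW hρ hsubρ⟩
    · exact AffineMap.lineMap_continuous.continuousOn
    · intro t ht
      rw [lineMap_eq]
      exact hreg ρ hρ (hρlt.trans_le (min_le_right _ _)) t ht
    · rintro _ ⟨a, ⟨ha, hqa⟩, rfl⟩
      rw [AffineMap.lineMap_apply_zero]
      apply Complex.ext
      · have h1 : s * ((f x).re - (f (φ a)).re) = ρ := hqa
        rw [← h1]
        linear_combination ((f x).re - (f (φ a)).re) * hs
      · exact hconst _ (hφ.mem_submanifold (hW ha))

end Thimble

end LefschetzThimble

end

/-! ### The two signs -/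

open LefschetzThimble in
theorem theorem5p6
    {E : Type*} [NormedAddCommGroup E] [NormedSpace ℂ E] [FiniteDimensional ℂ E]
    {N : Type*} [TopologicalSpace N] [T2Space N] [ChartedSpace E N] [IsManifold 𝓘(ℂ, E) ω N]
    (h : KaehlerMetric E N) (f : N → ℂ) (hf : IsLefschetzFibration E f)
    (V : Set N) (hV : IsLagrangianSubmanifold h.toHermitianMetric V)
    (x : N) (hxV : x ∈ V) (hx : IsCriticalPoint (E := E) f x)
    (f₁ f₂ : N → ℝ) (hf₁ : ∀ y, f₁ y = (f y).re) (hf₂ : ∀ y, f₂ y = (f y).im)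
    (hconst : ∀ y ∈ V, f₂ y = f₂ x) :
    -- the negative definite case
    ((∀ v ∈ tangentVectors E V x, v ≠ 0 → (hessian f x v v).re < 0) →
      (∀ c : ℝ, Subtype.val '' (V.domRestrict f₁ ⁻¹' Icc c (f₁ x)) = f₁ ⁻¹' Icc c (f₁ x) ∩ V) ∧
      (∀ᶠ U in (𝓝 x).smallSets, U ∈ 𝓝 x → ∀ᶠ c in 𝓝[<] (f₁ x),
        f₁ ⁻¹' Icc c (f₁ x) ∩ V ∩ U = connectedComponentIn (f₁ ⁻¹' Icc c (f₁ x) ∩ V) x) ∧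
      ∀ᶠ c in 𝓝[<] (f₁ x), ∀ D, D = connectedComponentIn (f₁ ⁻¹' Icc c (f₁ x) ∩ V) x →
        Nonempty (D ≃ₜ closedBall (0 : EuclideanSpace ℝ (Fin (Module.finrank ℂ E))) 1) ∧
        IsLagrangianThimble h.toHermitianMetric f
          (fun t => AffineMap.lineMap (k := ℝ) (⟨c, f₂ x⟩ : ℂ) (f x) t) x (D ∩ f₁ ⁻¹' {c}) D) ∧
    -- the positive definite case
    ((∀ v ∈ tangentVectors E V x, v ≠ 0 → 0 < (hessian f x v v).re) →
      (∀ c : ℝ, Subtype.val '' (V.domRestrict f₁ ⁻¹' Icc (f₁ x) c) = f₁ ⁻¹' Icc (f₁ x) c ∩ V) ∧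
      (∀ᶠ U in (𝓝 x).smallSets, U ∈ 𝓝 x → ∀ᶠ c in 𝓝[>] (f₁ x),
        f₁ ⁻¹' Icc (f₁ x) c ∩ V ∩ U = connectedComponentIn (f₁ ⁻¹' Icc (f₁ x) c ∩ V) x) ∧
      ∀ᶠ c in 𝓝[>] (f₁ x), ∀ D, D = connectedComponentIn (f₁ ⁻¹' Icc (f₁ x) c ∩ V) x →
        Nonempty (D ≃ₜ closedBall (0 : EuclideanSpace ℝ (Fin (Module.finrank ℂ E))) 1) ∧
        IsLagrangianThimble h.toHermitianMetric f
          (fun t => AffineMap.lineMap (k := ℝ) (⟨c, f₂ x⟩ : ℂ) (f x) t) x (D ∩ f₁ ⁻¹' {c}) D) := by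
  obtain rfl : f₁ = fun y => (f y).re := funext hf₁
  obtain rfl : f₂ = fun y => (f y).im := funext hf₂
  have hval : ∀ I : Set ℝ, Subtype.val '' (V.domRestrict (fun y => (f y).re) ⁻¹' I) =
      (fun y => (f y).re) ⁻¹' I ∩ V := fun I => by
    ext y
    constructor
    · rintro ⟨⟨z, hz⟩, hzI, rfl⟩
      exact ⟨hzI, hz⟩
    · rintro ⟨hy, hyV⟩
      exact ⟨⟨y, hyV⟩, hy, rfl⟩
  constructor
  · intro hdef
    -- Here `ρ = f₁ x - c`; in the positive definite case `s = -1` and `ρ = c - f₁ x`.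
    obtain ⟨⟨O, hO, h1⟩, ρ₀, hρ₀, h2⟩ := exists_thimble hf hV hxV hx hconst (s := 1) (by norm_num)
      (fun v hv hv0 => by linarith [hdef v hv hv0]) rfl
    have hK : ∀ c : ℝ, (fun y => 1 * ((f x).re - (f y).re)) ⁻¹' Icc 0 ((f x).re - c) =
        (fun y => (f y).re) ⁻¹' Icc c (f x).re := fun c => by
      ext y
      simp only [mem_preimage, mem_Icc]
      constructor <;> rintro ⟨h3, h4⟩ <;> constructor <;> linarith
    have hα : ∀ c : ℝ, (fun y => 1 * ((f x).re - (f y).re)) ⁻¹' {(f x).re - c} =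
        (fun y => (f y).re) ⁻¹' {c} := fun c => by
      ext y
      simp only [mem_preimage, mem_singleton_iff]
      constructor <;> intro h3 <;> linarith
    have hc : ∀ c : ℝ, (f x).re - 1 * ((f x).re - c) = c := fun c => by ring
    refine ⟨fun c => hval _, eventually_smallSets.2 ⟨O, hO, fun U hUO hU => ?_⟩, ?_⟩
    · obtain ⟨ρ₁, hρ₁, h3⟩ := h1 U hUO hU
      filter_upwards [Ioo_mem_nhdsLT (sub_lt_self (f x).re hρ₁)] with c hcI
      have h4 := h3 ((f x).re - c) (by linarith [hcI.2]) (by linarith [hcI.1])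
      rwa [hK] at h4
    · filter_upwards [Ioo_mem_nhdsLT (sub_lt_self (f x).re hρ₀)] with c hcI
      have h4 := h2 ((f x).re - c) (by linarith [hcI.2]) (by linarith [hcI.1])
      rwa [hK, hα, hc] at h4
  · intro hdef
    obtain ⟨⟨O, hO, h1⟩, ρ₀, hρ₀, h2⟩ := exists_thimble hf hV hxV hx hconst (s := -1) (by norm_num)
      (fun v hv hv0 => by linarith [hdef v hv hv0]) rfl
    have hK : ∀ c : ℝ, (fun y => -1 * ((f x).re - (f y).re)) ⁻¹' Icc 0 (c - (f x).re) =
        (fun y => (f y).re) ⁻¹' Icc (f x).re c := fun c => by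
      ext y
      simp only [mem_preimage, mem_Icc]
      constructor <;> rintro ⟨h3, h4⟩ <;> constructor <;> linarith
    have hα : ∀ c : ℝ, (fun y => -1 * ((f x).re - (f y).re)) ⁻¹' {c - (f x).re} =
        (fun y => (f y).re) ⁻¹' {c} := fun c => by
      ext y
      simp only [mem_preimage, mem_singleton_iff]
      constructor <;> intro h3 <;> linarith
    have hc : ∀ c : ℝ, (f x).re - -1 * (c - (f x).re) = c := fun c => by ring
    refine ⟨fun c => hval _, eventually_smallSets.2 ⟨O, hO, fun U hUO hU => ?_⟩, ?_⟩
    · obtain ⟨ρ₁, hρ₁, h3⟩ := h1 U hUO hU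
      filter_upwards [Ioo_mem_nhdsGT (lt_add_of_pos_right (f x).re hρ₁)] with c hcI
      have h4 := h3 (c - (f x).re) (by linarith [hcI.1]) (by linarith [hcI.2])
      rwa [hK] at h4
    · filter_upwards [Ioo_mem_nhdsGT (lt_add_of_pos_right (f x).re hρ₀)] with c hcI
      have h4 := h2 (c - (f x).re) (by linarith [hcI.1]) (by linarith [hcI.2])
      rwa [hK, hα, hc] at h4
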